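/- Setting. Time is $t=0,1,2,\dots$; states and actions are $\Theta=A=\{0,1\}$, and beliefs are identified with the probability $\mu\in[0,1]$ of state $1$. The prior is $\mu_0\in(0,1)$. A dynamic information structure $I$ is a probability law of paths $(\mu_t,m_t)_{t\ge 1}$ of beliefs and real messages such that $(\mu_t)_{t\ge0}$, started at the prior $\mu_0$, is a martingale for the filtration generated by the histories $(\mu_s,m_s)_{s\le t}$. Facing $I$, a decision maker (DM) with utility $u:A\times\Theta\to\mathbb R$, $u(0,0)>u(1,0)$, $u(1,1)>u(0,1)$, and per-period delay cost $c>0$ chooses a stopping time $\tau$ of that filtration and an action $a_\tau$, measurable with respect to the history at $\tau$, to maximize $\mathbb E^I[u(a_\tau,\theta)-c\tau]$; she breaks indifference between stopping and continuing in favour of continuing, and indifference between actions in favour of action $1$. For $f:A\times\{0,1,2,\dots\}\to\mathbb R_{\ge0}$, call $I$ designer-optimal for $f$ if, with the DM responding in this way, it maximizes $\mathbb E^I[f(a_\tau,\tau)]\in[0,\infty]$ over all dynamic information structures. Proposition. Let $h:\{0,1,2,\dots\}\to\mathbb R_{\ge 0}$ be (weakly) increasing. Then there is a dynamic information structure $I$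 that is designer-optimal for $f(a,\tau)=a+h(\tau)$ and has one of the following two forms: (i) (Pure attention capture) $I$ is also designer-optimal for the objective $h(\tau)$ alone, and under $I$ the DM almost surely stops with a degenerate belief, $\mu_\tau\in\{0,1\}$; or (ii) (One-shot persuasion) there is a deterministic time $T$ such that $I$ reveals information only at time $T$ (almost surely $\mu_t=\mu_0$ for all $t<T$ and $\mu_t=\mu_T$ for all $t\ge T$) and the DM stops at time $T$ almost surely. -/

import Mathlib

open MeasureTheory
open scoped NNReal ENNReal

namespace AttentionCapture

/-- A path of belief-message pairs. The entry at `t` is the pair `(μ_t, m_t)`; a belief is the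
probability in `[0, 1]` of state `1`, and messages are real numbers. -/
abbrev Path : Type := ℕ → unitInterval × ℝ

/-- The natural filtration: at time `t` the history `(μ_s, m_s)`, `s ≤ t`, is known. -/
noncomputable def history : Filtration ℕ (inferInstance : MeasurableSpace Path) :=
  Filtration.piLE (X := fun _ : ℕ => unitInterval × ℝ)

/-- The belief (probability of state `1`) at time `t`. -/
def belief (t : ℕ) (ω : Path) : ℝ := ((ω t).1 : ℝ)

/-- A dynamic information structure with the given prior: a law of belief-message paths under
which beliefs form a martingale. Information arrives from time `1` on: at time `0` the belief is
the prior and the message is a constant dummy. -/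
structure InfoStructure (prior : unitInterval) where
  law : Measure Path
  isProb : IsProbabilityMeasure law
  initial : ∀ᵐ ω ∂law, ω 0 = (prior, 0)
  martingale : Martingale belief history law

/-- A strategy of the decision maker facing `S`: a stopping time of the natural filtration and the
action taken upon stopping at each time. The stopping time is almost surely finite with finite
mean; any other one has expected payoff `-∞`, and so is never a best response. -/
structure Strategy {prior : unitInterval} (S : InfoStructure prior) where
  tau : Path → WithTop ℕ
  isStoppingTime : IsStoppingTime history tau
  finite : ∀ᵐ ω ∂S.law, tau ω ≠ ⊤
  integrable : Integrable (fun ω => (((tau ω).untopD 0 : ℕ) : ℝ)) S.law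
  act : ℕ → Path → Fin 2
  adapted : ∀ t, Measurable[history t] (act t)

/-- Expected utility of action `a` (delay costs aside) at belief `μ`; `u a θ` is the utility of
action `a` in state `θ`. -/
def expUtility (u : Fin 2 → Fin 2 → ℝ) (a : Fin 2) (μ : ℝ) : ℝ :=
  (1 - μ) * u a 0 + μ * u a 1

namespace Strategy

variable {prior : unitInterval} {S : InfoStructure prior}

/-- The stopping time as a natural number (the value on the null set `tau = ⊤` is irrelevant). -/
def time (s : Strategy S) (ω : Path) : ℕ := (s.tau ω).untopD 0

/-- The action `a_τ`. -/
def action (s : Strategy S) (ω : Path) : Fin 2 := s.act (s.time ω) ω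

/-- The stopping belief `μ_τ`. -/
def stopBelief (s : Strategy S) (ω : Path) : ℝ := belief (s.time ω) ω

/-- Expected payoff `E[u(a_τ, θ) - c τ]` of the decision maker. -/
noncomputable def dmPayoff (u : Fin 2 → Fin 2 → ℝ) (c : ℝ) (s : Strategy S) : ℝ :=
  ∫ ω, (expUtility u (s.action ω) (s.stopBelief ω) - c * (s.time ω : ℝ)) ∂S.law

/-- `s` solves the decision maker's problem. -/
def IsDMOptimal (u : Fin 2 → Fin 2 → ℝ) (c : ℝ) (s : Strategy S) : Prop :=
  ∀ s' : Strategy S, dmPayoff u c s' ≤ dmPayoff u c s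

/-- `s` is the decision maker's behaviour under `S`: it solves her problem, she breaks
indifference between stopping and continuing in favour of continuing (so her stopping time is the
largest optimal one), and she breaks indifference between the actions in favour of action `1`. -/
def IsResponse (u : Fin 2 → Fin 2 → ℝ) (c : ℝ) (s : Strategy S) : Prop :=
  IsDMOptimal u c s ∧
  (∀ s' : Strategy S, IsDMOptimal u c s' → ∀ᵐ ω ∂S.law, s'.tau ω ≤ s.tau ω) ∧
  ∀ᵐ ω ∂S.law, expUtility u 0 (s.stopBelief ω) ≤ expUtility u 1 (s.stopBelief ω) →
    s.action ω = 1

/-- The designer's expected payoff `E[f(a_τ, τ)]`, for nonnegative `f`. -/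
noncomputable def designerValue (f : Fin 2 → ℕ → ℝ≥0) (s : Strategy S) : ℝ≥0∞ :=
  ∫⁻ ω, (f (s.action ω) (s.time ω) : ℝ≥0∞) ∂S.law

/-- The decision maker's stopping belief is almost surely degenerate. -/
def StopsFullyInformed (s : Strategy S) : Prop :=
  ∀ᵐ ω ∂S.law, s.stopBelief ω = 0 ∨ s.stopBelief ω = 1

end Strategy

/-- The structure `S`, to which the decision maker responds with `s`, maximizes the designer's
expected payoff `E[f(a_τ, τ)]` among all dynamic information structures. -/
def IsDesignerOptimal {prior : unitInterval} (u : Fin 2 → Fin 2 → ℝ) (c : ℝ)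
    (f : Fin 2 → ℕ → ℝ≥0) (S : InfoStructure prior) (s : Strategy S) : Prop :=
  s.IsResponse u c ∧
  ∀ (S' : InfoStructure prior) (s' : Strategy S'), s'.IsResponse u c →
    s'.designerValue f ≤ s.designerValue f

/-- Information is revealed at time `T` only: beliefs stay at the prior before `T` and do not move
after `T`. -/
def InfoStructure.RevealsOnlyAt {prior : unitInterval} (S : InfoStructure prior) (T : ℕ) : Prop :=
  (∀ t < T, ∀ᵐ ω ∂S.law, belief t ω = prior) ∧
  ∀ t, T ≤ t → ∀ᵐ ω ∂S.law, belief t ω = belief T ω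

end AttentionCapture

/-! Full information is affine in the belief, so by optional stopping the DM in effect minimizes the
expected loss relative to full information plus the delay cost. The designer's problem then relaxes
to a linear program in scalar sequences. For a DM who does not stop at once, put `S t = P(τ > t)`,
let `q t` be the expected loss at `τ = t + 1` divided by `c`, and let `B t` be the expected
remaining delay plus loss (over `c`) on `τ > t`. Then `B t = S t + q t + B (t + 1)`. Comparison with
stopping at `t` gives `B t ≤ K * S t`, where `K` is the normalized loss at the kink, and `B 0 ≤ K₀`,
the normalized loss at the prior. Since action `1` at belief `μ` loses `(u 0 0 - u 1 0) * (1 - μ)`,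
the probability of action `1` is at most `prior + β * ∑ q` with `β = c / (u 0 0 - u 1 0)`. The
designer's value is thus bounded by a linear function of `S` and `q` (`IsDMOptimal.feasible`,
`IsDMOptimal.designerValue_le`).

The heart is the shape of an optimal plan (`optimal_plan_form`). Among the maximizers take one that
minimizes `∑ 2⁻ᵘ q u`, and suppose `q ≠ 0` with first nonzero entry at `j`. If some but not all of
the probability stops at a date `i + 1 ≤ j + 1`, the continuation after `i + 1` can be scaled up,
paid for out of `q j`. The value is linear in the scale, and truncating the continuation does not
raise it, so scaling up does not lower it; but it strictly lowers the secondary criterion. Hence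
nobody stops before `j + 1`. If nobody stopped at `j + 1` either, `q j` could be postponed. So
everyone stops at `j + 1`. Either no loss is left or the stopping time is deterministic.

Both shapes are implementable. A lossless plan is realized by revealing states so that the
continuation belief moves towards the kink (`exists_pure`); a deterministic time by a split of the
prior into `0`, the kink and `1` (`exists_oneShot`). Obedience need only be checked at deterministic
times, because the history before the recommendation to stop is deterministic
(`IsRecommendation.isResponse`). The remaining competitor, stopping at once, is one-shot persuasion
with `T = 0`. -/

namespace AttentionCapture

/-! ### Feasible plans and their geometric decay -/

/-- The sequential constraints on stopping: `S u` is the probability of stopping after `u`, `q u`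
is the (normalized) loss left to the decision maker when stopping at `u + 1`, and `B t` bounds the
total cost of continuing at `t`. -/
structure Feasible (K K₀ : ℝ) (S q B : ℕ → ℝ) : Prop where
  start : S 0 = 1
  S_nonneg : ∀ u, 0 ≤ S u
  S_succ_le : ∀ u, S (u + 1) ≤ S u
  q_nonneg : ∀ u, 0 ≤ q u
  B_nonneg : ∀ u, 0 ≤ B u
  cost : ∀ u, S u + q u + B (u + 1) ≤ B u
  bound : ∀ u, B u ≤ K * S u
  budget : B 0 ≤ K₀

/-- An upper bound on the cost sequence of a feasible plan. -/
noncomputable def costBound (K K₀ : ℝ) : ℕ → ℝ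
  | 0 => K₀
  | u + 1 => (K₀ - 1) * (1 - 1 / K) ^ u

namespace Feasible

variable {K K₀ : ℝ} {S q B : ℕ → ℝ}

lemma S_antitone (hF : Feasible K K₀ S q B) : Antitone S := antitone_nat_of_succ_le hF.S_succ_le

lemma S_le_B (hF : Feasible K K₀ S q B) (u : ℕ) : S u ≤ B u := by
  linarith [hF.cost u, hF.q_nonneg u, hF.B_nonneg (u + 1)]

lemma q_le_B (hF : Feasible K K₀ S q B) (u : ℕ) : q u ≤ B u := by
  linarith [hF.cost u, hF.S_nonneg u, hF.B_nonneg (u + 1)]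

lemma B_antitone (hF : Feasible K K₀ S q B) : Antitone B := antitone_nat_of_succ_le fun u => by
  linarith [hF.cost u, hF.S_nonneg u, hF.q_nonneg u]

lemma S_le_one (hF : Feasible K K₀ S q B) (u : ℕ) : S u ≤ 1 :=
  hF.start ▸ hF.S_antitone (Nat.zero_le u)

/-- The constraint `B u ≤ K * S u` means that each period of continuing uses up at least a fraction
`1 / K` of the remaining cost. Period `0` uses a full unit because `S 0 = 1`, whence the factor `K₀
- 1`. -/
lemma B_le_costBound (hK : 1 ≤ K) (hF : Feasible K K₀ S q B) (u : ℕ) : B u ≤ costBound K K₀ u := by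
  have hK0 : 0 < K := by linarith
  have hr : 0 ≤ 1 - 1 / K := by
    rw [sub_nonneg, div_le_one hK0]; exact hK
  cases u with
  | zero => exact hF.budget
  | succ u =>
    simp only [costBound]
    induction u with
    | zero =>
      have := hF.cost 0
      simp only [zero_add, pow_zero, mul_one] at *
      linarith [hF.start, hF.q_nonneg 0, hF.budget]
    | succ u ih =>
      have h1 := hF.cost (u + 1)
      have h2 := hF.bound (u + 1)
      have h3 : B (u + 1 + 1) ≤ (1 - 1 / K) * B (u + 1) := by
        have h4 : B (u + 1) / K ≤ S (u + 1) := by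
          rw [div_le_iff₀ hK0]; linarith
        have : (1 - 1 / K) * B (u + 1) = B (u + 1) - B (u + 1) / K := by ring
        linarith [hF.q_nonneg (u + 1)]
      calc B (u + 1 + 1) ≤ (1 - 1 / K) * B (u + 1) := h3
        _ ≤ (1 - 1 / K) * ((K₀ - 1) * (1 - 1 / K) ^ u) := by gcongr
        _ = _ := by ring

end Feasible

lemma costBound_nonneg {K K₀ : ℝ} (hK : 1 ≤ K) (hK₀ : 1 ≤ K₀) (u : ℕ) : 0 ≤ costBound K K₀ u := by
  have hK0 : 0 < K := by linarith
  have hr : 0 ≤ 1 - 1 / K := by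
    rw [sub_nonneg, div_le_one hK0]; exact hK
  cases u with
  | zero => simp only [costBound]; linarith
  | succ u => simp only [costBound]; exact mul_nonneg (by linarith) (pow_nonneg hr u)

lemma summable_costBound {K K₀ : ℝ} (hK : 1 ≤ K) : Summable (costBound K K₀) := by
  have hK0 : 0 < K := by linarith
  have hr : 0 ≤ 1 - 1 / K := by
    rw [sub_nonneg, div_le_one hK0]; exact hK
  rw [← summable_nat_add_iff 1]
  exact (summable_geometric_of_lt_one hr (by simp [hK0])).mul_left (K₀ - 1)

/-! ### Existence of an optimal plan -/

/-- The set of feasible plans, as a subset of a product space. -/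
def feasibleSet (K K₀ : ℝ) : Set ((ℕ → ℝ) × (ℕ → ℝ) × (ℕ → ℝ)) :=
  {x | Feasible K K₀ x.1 x.2.1 x.2.2}

/-- Each constraint is closed and involves finitely many coordinates; all coordinates lie in `[0,
1]` or `[0, K₀]`, so Tychonoff applies. -/
lemma isCompact_feasibleSet {K K₀ : ℝ} : IsCompact (feasibleSet K K₀) := by
  have hbig : IsCompact ((Set.univ.pi fun _ : ℕ => Set.Icc (0 : ℝ) 1) ×ˢ
      ((Set.univ.pi fun _ : ℕ => Set.Icc (0 : ℝ) K₀) ×ˢ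
        (Set.univ.pi fun _ : ℕ => Set.Icc (0 : ℝ) K₀))) :=
    (isCompact_univ_pi fun _ => isCompact_Icc).prod
      ((isCompact_univ_pi fun _ => isCompact_Icc).prod (isCompact_univ_pi fun _ => isCompact_Icc))
  refine hbig.of_isClosed_subset ?_ ?_
  · have : feasibleSet K K₀ = {x | x.1 0 = 1} ∩ (⋂ u, {x | 0 ≤ x.1 u}) ∩
        (⋂ u, {x | x.1 (u + 1) ≤ x.1 u}) ∩ (⋂ u, {x | 0 ≤ x.2.1 u}) ∩ (⋂ u, {x | 0 ≤ x.2.2 u}) ∩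
        (⋂ u, {x | x.1 u + x.2.1 u + x.2.2 (u + 1) ≤ x.2.2 u}) ∩
        (⋂ u, {x | x.2.2 u ≤ K * x.1 u}) ∩ {x | x.2.2 0 ≤ K₀} := by
      ext x
      simp only [Set.mem_inter_iff, Set.mem_iInter, Set.mem_ofPred_eq, feasibleSet]
      constructor
      · rintro ⟨a, b, c, d, e, f, g, h⟩
        exact ⟨⟨⟨⟨⟨⟨⟨a, b⟩, c⟩, d⟩, e⟩, f⟩, g⟩, h⟩
      · rintro ⟨⟨⟨⟨⟨⟨⟨a, b⟩, c⟩, d⟩, e⟩, f⟩, g⟩, h⟩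
        exact ⟨a, b, c, d, e, f, g, h⟩
    rw [this]
    refine IsClosed.inter (IsClosed.inter (IsClosed.inter (IsClosed.inter (IsClosed.inter
      (IsClosed.inter (IsClosed.inter ?_ ?_) ?_) ?_) ?_) ?_) ?_) ?_
    · exact isClosed_eq (by fun_prop) (by fun_prop)
    all_goals first
      | exact isClosed_iInter fun u => isClosed_le (by fun_prop) (by fun_prop)
      | exact isClosed_le (by fun_prop) (by fun_prop)
  · rintro ⟨S, q, B⟩ hF
    replace hF : Feasible K K₀ S q B := hF
    have hB : ∀ u, B u ≤ K₀ := fun u => (hF.B_antitone (Nat.zero_le u)).trans hF.budget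
    exact ⟨fun u _ => ⟨hF.S_nonneg u, hF.S_le_one u⟩,
      fun u _ => ⟨hF.q_nonneg u, (hF.q_le_B u).trans (hB u)⟩,
      fun u _ => ⟨hF.B_nonneg u, hB u⟩⟩

lemma feasibleSet_nonempty {K K₀ : ℝ} (hK : 1 ≤ K) (hK₀ : 1 ≤ K₀) :
    (feasibleSet K K₀).Nonempty := by
  -- Everyone stops at time `1`, without loss.
  refine ⟨(fun u => if u = 0 then 1 else 0, fun _ => 0, fun u => if u = 0 then 1 else 0), ?_⟩
  constructor <;> intros <;> dsimp only <;> (try split_ifs) <;> simp_all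

/-- The part of the designer's objective that depends on the plan. -/
noncomputable def planValue (Δ : ℕ → ℝ) (β : ℝ) (S q : ℕ → ℝ) : ℝ :=
  ∑' u, Δ u * S u + β * ∑' u, q u

section Optimum

variable {K K₀ β : ℝ} {Δ : ℕ → ℝ}

namespace Feasible

variable {S q B : ℕ → ℝ}

lemma summable_q (hK : 1 ≤ K) (hF : Feasible K K₀ S q B) : Summable q :=
  Summable.of_nonneg_of_le hF.q_nonneg
    (fun u => (hF.q_le_B u).trans (hF.B_le_costBound hK u)) (summable_costBound hK)

lemma summable_S (hK : 1 ≤ K) (hF : Feasible K K₀ S q B) : Summable S :=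
  Summable.of_nonneg_of_le hF.S_nonneg
    (fun u => (hF.S_le_B u).trans (hF.B_le_costBound hK u)) (summable_costBound hK)

lemma summable_ΔS (hK : 1 ≤ K) (hΔ : ∀ u, 0 ≤ Δ u)
    (hs : Summable fun u => Δ u * costBound K K₀ u) (hF : Feasible K K₀ S q B) :
    Summable fun u => Δ u * S u :=
  Summable.of_nonneg_of_le (fun u => mul_nonneg (hΔ u) (hF.S_nonneg u))
    (fun u => mul_le_mul_of_nonneg_left ((hF.S_le_B u).trans (hF.B_le_costBound hK u)) (hΔ u)) hs

/-- The loss from `s` on is part of the cost of continuing at `s`. -/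
lemma S_add_tsum_q_le (hK : 1 ≤ K) (hF : Feasible K K₀ S q B) (s : ℕ) :
    S s + ∑' u, (if s ≤ u then q u else 0) ≤ B s := by
  have hsum : ∀ N, S s + ∑ i ∈ Finset.range N, (if s ≤ i then q i else 0) +
      (if s < N then B N else B s - S s) ≤ B s := by
    intro N
    induction N with
    | zero => simp
    | succ N ih =>
      rw [Finset.sum_range_succ]
      have hc := hF.cost N
      have hSN := hF.S_nonneg N
      rcases lt_trichotomy s N with h | h | h
      · rw [if_pos h] at ih
        rw [if_pos h.le, if_pos (by omega)]
        linarith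
      · subst h
        rw [if_neg (lt_irrefl _)] at ih
        rw [if_pos le_rfl, if_pos (by omega)]
        linarith
      · rw [if_neg (by omega)] at ih
        rw [if_neg (by omega), if_neg (by omega)]
        linarith
  have hq : Summable fun u => if s ≤ u then q u else 0 :=
    Summable.of_nonneg_of_le (fun u => by split_ifs <;> simp [hF.q_nonneg])
      (fun u => by split_ifs <;> simp [hF.q_nonneg]) (hF.summable_q hK)
  have := hq.tsum_le_of_sum_range_le (c := B s - S s) fun N => by
    have h1 := hsum N
    have h2 : 0 ≤ (if s < N then B N else B s - S s) := by
      split_ifs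
      · exact hF.B_nonneg N
      · linarith [hF.S_le_B s]
    linarith
  linarith

end Feasible

/-- Weierstrass twice, for a lexicographic optimum: `costBound` is a summable majorant that makes
both objectives continuous in the product topology. The decreasing weights of the secondary
criterion penalize the size of the loss as well as its earliness. -/
lemma exists_optimal_plan (hK : 1 ≤ K) (hK₀ : 1 ≤ K₀) (hΔ : ∀ u, 0 ≤ Δ u)
    (hs : Summable fun u => Δ u * costBound K K₀ u) :
    ∃ S q B, Feasible K K₀ S q B ∧
      (∀ S' q' B', Feasible K K₀ S' q' B' → planValue Δ β S' q' ≤ planValue Δ β S q) ∧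
      (∀ S' q' B', Feasible K K₀ S' q' B' → planValue Δ β S q ≤ planValue Δ β S' q' →
        ∑' u, (1 / 2 : ℝ) ^ u * q u ≤ ∑' u, (1 / 2 : ℝ) ^ u * q' u) := by
  have hcomp := isCompact_feasibleSet (K := K) (K₀ := K₀)
  have hcont : ContinuousOn (fun x : (ℕ → ℝ) × (ℕ → ℝ) × (ℕ → ℝ) => planValue Δ β x.1 x.2.1)
      (feasibleSet K K₀) := by
    refine ContinuousOn.add ?_ (continuousOn_const.mul ?_)
    · refine continuousOn_tsum (fun u => by fun_prop) hs fun u x hx => ?_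
      replace hx : Feasible K K₀ _ _ _ := hx
      rw [Real.norm_of_nonneg (mul_nonneg (hΔ u) (hx.S_nonneg u))]
      exact mul_le_mul_of_nonneg_left ((hx.S_le_B u).trans (hx.B_le_costBound hK u)) (hΔ u)
    · refine continuousOn_tsum (fun u => by fun_prop) (summable_costBound (K₀ := K₀) hK)
        fun u x hx => ?_
      replace hx : Feasible K K₀ _ _ _ := hx
      rw [Real.norm_of_nonneg (hx.q_nonneg u)]
      exact (hx.q_le_B u).trans (hx.B_le_costBound hK u)
  have hcont' : ContinuousOn (fun x : (ℕ → ℝ) × (ℕ → ℝ) × (ℕ → ℝ) =>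
      ∑' u, (1 / 2 : ℝ) ^ u * x.2.1 u) (feasibleSet K K₀) := by
    refine continuousOn_tsum (fun u => by fun_prop) (summable_costBound (K₀ := K₀) hK)
      fun u x hx => ?_
    replace hx : Feasible K K₀ _ _ _ := hx
    have h1 : (1 / 2 : ℝ) ^ u ≤ 1 := pow_le_one₀ (by norm_num) (by norm_num)
    have h0 : (0 : ℝ) ≤ (1 / 2 : ℝ) ^ u := by positivity
    rw [Real.norm_of_nonneg (mul_nonneg h0 (hx.q_nonneg u))]
    calc (1 / 2 : ℝ) ^ u * x.2.1 u ≤ 1 * x.2.1 u := by gcongr; exact hx.q_nonneg u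
      _ ≤ _ := by rw [one_mul]; exact (hx.q_le_B u).trans (hx.B_le_costBound hK u)
  obtain ⟨x, hx, hmax⟩ := hcomp.exists_isMaxOn (feasibleSet_nonempty hK hK₀) hcont
  have hcomp2 : IsCompact (feasibleSet K K₀ ∩
      (fun x : (ℕ → ℝ) × (ℕ → ℝ) × (ℕ → ℝ) => planValue Δ β x.1 x.2.1) ⁻¹'
        Set.Ici (planValue Δ β x.1 x.2.1)) :=
    hcomp.of_isClosed_subset
      (hcont.preimage_isClosed_of_isClosed hcomp.isClosed isClosed_Ici) Set.inter_subset_left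
  obtain ⟨y, hy, hmin⟩ := hcomp2.exists_isMinOn ⟨x, hx, le_refl (planValue Δ β x.1 x.2.1)⟩
    (hcont'.mono Set.inter_subset_left)
  refine ⟨y.1, y.2.1, y.2.2, hy.1, fun S' q' B' hF => ?_, fun S' q' B' hF hle => ?_⟩
  · exact (hmax (a := (S', q', B')) hF).trans hy.2
  · exact hmin (a := (S', q', B')) ⟨hF, le_trans hy.2 hle⟩

end Optimum

/-! ### Exchange arguments and the form of an optimal plan -/

section Exchange

variable {K K₀ β : ℝ} {Δ S q B : ℕ → ℝ}

lemma summable_ite_le {f : ℕ → ℝ} (hf : Summable f) (s : ℕ) :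
    Summable fun u => if s ≤ u then f u else 0 := by
  have : (fun u => if s ≤ u then f u else 0) = Set.indicator (Set.Ici s) f := by
    ext u
    simp [Set.indicator_apply]
  rw [this]
  exact hf.indicator _

/-- Rescale the continuation from `s` on by the factor `1 + e`. -/
def scaleFrom (s : ℕ) (e : ℝ) (S : ℕ → ℝ) (u : ℕ) : ℝ := S u + e * (if s ≤ u then S u else 0)

/-- Rescale from `s` on by the factor `1 + e`, and pay the cost `e * b` at `j`. -/
def scaleFromPaying (s j : ℕ) (e b : ℝ) (q : ℕ → ℝ) (u : ℕ) : ℝ :=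
  q u + e * ((if s ≤ u then q u else 0) - (if u = j then b else 0))

/-- The cost sequence that results from rescaling from `s` on and paying at `j`. -/
def scaleCost (s j : ℕ) (e : ℝ) (B : ℕ → ℝ) (u : ℕ) : ℝ :=
  B u + e * ((if s ≤ u then B u else 0) - (if s ≤ u ∧ u ≤ j then B s else 0))

lemma tsum_mul_scaleFromPaying {w : ℕ → ℝ} (hq : Summable fun u => w u * q u) (s j : ℕ) (e b : ℝ) :
    ∑' u, w u * scaleFromPaying s j e b q u =
      ∑' u, w u * q u + e * (∑' u, (if s ≤ u then w u * q u else 0) - w j * b) := by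
  have h1 : HasSum (fun u => if s ≤ u then w u * q u else 0)
      (∑' u, if s ≤ u then w u * q u else 0) := (summable_ite_le hq s).hasSum
  have h2 : HasSum (fun u => if u = j then w j * b else 0) (w j * b) := hasSum_ite_eq j _
  have h3 := hq.hasSum.add ((h1.sub h2).mul_left e)
  rw [← h3.tsum_eq]
  congr 1
  ext u
  unfold scaleFromPaying
  split_ifs <;> simp_all <;> ring

/-- The change is linear in `e`, and the payment date `j` drops out because losses at all dates have
the same weight `β`. So truncation (`e = -1`, paid at one date) and scaling up (`e > 0`, paid at
another) change the value in opposite directions. -/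
lemma planValue_scale (hS : Summable fun u => Δ u * S u) (hq : Summable q) (s j : ℕ) (e b : ℝ) :
    planValue Δ β (scaleFrom s e S) (scaleFromPaying s j e b q) = planValue Δ β S q +
      e * (∑' u, (if s ≤ u then Δ u * S u else 0) +
        β * (∑' u, (if s ≤ u then q u else 0) - b)) := by
  have h1 := tsum_mul_scaleFromPaying (w := fun _ => 1) (by simpa using hq) s j e b
  -- `S` is scaled like a loss sequence with nothing to pay.
  have h2 := tsum_mul_scaleFromPaying (w := Δ) hS s s e 0
  have h3 : ∀ u, scaleFromPaying s s e 0 S u = scaleFrom s e S u := fun u => by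
    simp [scaleFromPaying, scaleFrom]
  simp only [one_mul, h3, mul_zero, sub_zero] at h1 h2
  unfold planValue
  rw [h1, h2]
  ring

/-- Stopping at `j + 1` and leaving the decision maker the saved cost is feasible. -/
lemma Feasible.truncate (hF : Feasible K K₀ S q B) (j : ℕ) :
    Feasible K K₀ (scaleFrom (j + 1) (-1) S) (scaleFromPaying (j + 1) j (-1) (B (j + 1)) q)
      (scaleCost (j + 1) j (-1) B) := by
  have hB := hF.B_nonneg (j + 1)
  constructor
  · simp [scaleFrom, hF.start]
  · intro u
    have := hF.S_nonneg u
    unfold scaleFrom; split_ifs <;> linarith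
  · intro u
    have := hF.S_nonneg u
    have := hF.S_succ_le u
    have := hF.S_nonneg (u + 1)
    unfold scaleFrom; split_ifs <;> first | omega | linarith
  · intro u
    have := hF.q_nonneg u
    unfold scaleFromPaying; split_ifs <;> first | omega | linarith
  · intro u
    have := hF.B_nonneg u
    unfold scaleCost; split_ifs <;> first | omega | linarith
  · intro u
    have := hF.cost u
    have := hF.B_nonneg (u + 1)
    unfold scaleCost scaleFrom scaleFromPaying
    rcases lt_trichotomy u j with h | h | h
    · simp only [show ¬ j + 1 ≤ u by omega, show ¬ j + 1 ≤ u + 1 by omega, h.ne, if_false,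
        false_and]
      linarith
    · subst h
      simp
      linarith
    · simp only [show j + 1 ≤ u by omega, show j + 1 ≤ u + 1 by omega, h.ne', if_true, if_false,
        show ¬ u ≤ j by omega, show ¬ u + 1 ≤ j by omega, and_false]
      linarith
  · intro u
    have := hF.bound u
    unfold scaleCost scaleFrom
    split_ifs <;> first | omega | linarith
  · have := hF.budget
    simp [scaleCost, this]

/-- The payment at `j` exactly offsets the extra cost `e * B (i + 1)` seen from `i` or earlier.
Between `i + 1` and `j` the cost does not rise, since `B` is antitone, while `S` does not fall;
after `j` both scale alike. The two conditions on `e` keep `S` decreasing at `i` and `q j`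
nonnegative. -/
lemma Feasible.scale (hK : 0 ≤ K) (hF : Feasible K K₀ S q B) {i j : ℕ} (hij : i ≤ j) {e : ℝ}
    (he : 0 ≤ e) (heS : e * S (i + 1) ≤ S i - S (i + 1)) (heq : e * B (i + 1) ≤ q j) :
    Feasible K K₀ (scaleFrom (i + 1) e S) (scaleFromPaying (i + 1) j e (B (i + 1)) q)
      (scaleCost (i + 1) j e B) := by
  have hB := hF.B_nonneg (i + 1)
  constructor
  · simp [scaleFrom, hF.start]
  · intro u
    have := hF.S_nonneg u
    unfold scaleFrom; split_ifs <;> positivity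
  · intro u
    have h1 := hF.S_succ_le u
    have h2 := mul_le_mul_of_nonneg_left h1 he
    unfold scaleFrom
    rcases lt_trichotomy u i with h | h | h
    · simp only [show ¬ i + 1 ≤ u by omega, show ¬ i + 1 ≤ u + 1 by omega, if_false]
      linarith
    · subst h
      simp
      linarith
    · simp only [show i + 1 ≤ u by omega, show i + 1 ≤ u + 1 by omega, if_true]
      linarith
  · intro u
    have h1 := hF.q_nonneg u
    have h2 := mul_nonneg he h1
    unfold scaleFromPaying
    by_cases hu : u = j
    · subst hu
      simp only [if_true]
      split_ifs <;> linarith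
    · simp only [hu, if_false]
      split_ifs <;> linarith
  · intro u
    have h1 := hF.B_nonneg u
    have h2 := mul_nonneg he h1
    unfold scaleCost
    by_cases hu : i + 1 ≤ u ∧ u ≤ j
    · have h3 := hF.B_antitone hu.2
      have h4 := hF.q_le_B j
      simp only [hu.1, hu.2, and_self, if_true]
      linarith
    · simp only [hu, if_false]
      split_ifs <;> linarith
  · intro u
    have h1 := hF.cost u
    have h2 := mul_le_mul_of_nonneg_left h1 he
    unfold scaleCost scaleFrom scaleFromPaying
    rcases lt_trichotomy u i with h | h | h
    · simp only [show ¬ i + 1 ≤ u by omega, show ¬ i + 1 ≤ u + 1 by omega, if_false,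
        false_and, show u ≠ j by omega]
      linarith
    · subst h
      by_cases h' : u = j
      · subst h'
        simp
        linarith
      · simp [h', show u + 1 ≤ j by omega]
        linarith
    · simp only [show i + 1 ≤ u by omega, show i + 1 ≤ u + 1 by omega, if_true, true_and]
      rcases lt_trichotomy u j with h' | h' | h'
      · simp only [h'.ne, h'.le, show u + 1 ≤ j by omega, if_true, if_false]
        linarith
      · subst h'
        simp
        linarith
      · simp only [h'.ne', show ¬ u ≤ j by omega, show ¬ u + 1 ≤ j by omega, if_false]
        linarith
  · intro u
    have h1 := hF.bound u
    have h2 := mul_le_mul_of_nonneg_left h1 he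
    have h4 : 0 ≤ e * (K * S u) := mul_nonneg he (mul_nonneg hK (hF.S_nonneg u))
    unfold scaleCost scaleFrom
    by_cases hu : i + 1 ≤ u
    · have h3 := mul_le_mul_of_nonneg_left (hF.B_antitone hu) he
      simp only [hu, if_true, true_and]
      split_ifs <;> linarith
    · simp only [hu, if_false, false_and]
      linarith
  · have := hF.budget
    simp [scaleCost, this]

/-- Postponing the loss left at `j + 1` by one period, when nobody stops at `j + 1`. -/
lemma Feasible.postpone (hF : Feasible K K₀ S q B) {j : ℕ} (hj : S (j + 1) = S j) :
    Feasible K K₀ S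
      (fun u => q u + (if u = j + 1 then q j else 0) - (if u = j then q j else 0))
      (fun u => B u + if u = j + 1 then q j else 0) := by
  have hqj := hF.q_nonneg j
  refine ⟨hF.start, hF.S_nonneg, hF.S_succ_le, fun u => ?_, fun u => ?_, fun u => ?_, fun u => ?_,
    ?_⟩
  · have := hF.q_nonneg u
    split_ifs with h1 h2 h2
    · omega
    · linarith
    · subst h2; linarith
    · linarith
  · have := hF.B_nonneg u
    split_ifs <;> linarith
  · have := hF.cost u
    rcases eq_or_ne u j with h | h
    · subst h; simp; linarith
    · rcases eq_or_ne u (j + 1) with h' | h'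
      · subst h'; simp; linarith
      · simp [h, h']; linarith
  · have := hF.bound u
    split_ifs with h
    · subst h
      -- The postponed loss is covered by `B (j + 1) + q j ≤ B j - S j ≤ K * S j`, and `S j = S (j +
      -- 1)`.
      have := hF.cost j
      have := hF.bound j
      have := hF.S_nonneg j
      rw [hj]; linarith
    · linarith
  · have := hF.budget
    simp [this]

/-- An optimal plan that leaves as little loss as possible, as late as possible, either leaves no
loss at all, or stops at a deterministic time. -/
theorem optimal_plan_form (hK : 1 ≤ K) (hβ : 0 ≤ β) (hΔ : ∀ u, 0 ≤ Δ u)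
    (hs : Summable fun u => Δ u * costBound K K₀ u) (hF : Feasible K K₀ S q B)
    (hopt : ∀ S' q' B', Feasible K K₀ S' q' B' → planValue Δ β S' q' ≤ planValue Δ β S q)
    (hmin : ∀ S' q' B', Feasible K K₀ S' q' B' → planValue Δ β S q ≤ planValue Δ β S' q' →
      ∑' u, (1 / 2 : ℝ) ^ u * q u ≤ ∑' u, (1 / 2 : ℝ) ^ u * q' u) :
    (∀ u, q u = 0) ∨ ∃ T : ℕ, 1 ≤ T ∧ (T : ℝ) ≤ K₀ ∧
      planValue Δ β S q ≤ ∑ u ∈ Finset.range T, Δ u + β * (K₀ - T) := by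
  classical
  have hK0 : 0 ≤ K := by linarith
  have hq := hF.summable_q hK
  have hΔS := hF.summable_ΔS hK hΔ hs
  have hwq : Summable fun u => (1 / 2 : ℝ) ^ u * q u :=
    Summable.of_nonneg_of_le (fun u => mul_nonneg (by positivity) (hF.q_nonneg u))
      (fun u => mul_le_of_le_one_left (hF.q_nonneg u) (pow_le_one₀ (by norm_num) (by norm_num))) hq
  have htrunc : ∀ i, 0 ≤ ∑' u, (if i + 1 ≤ u then Δ u * S u else 0) +
      β * (∑' u, (if i + 1 ≤ u then q u else 0) - B (i + 1)) := by
    intro i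
    have h1 := hopt _ _ _ (hF.truncate i)
    rw [planValue_scale hΔS hq] at h1
    linarith
  by_cases hq0 : ∀ u, q u = 0
  · exact Or.inl hq0
  right
  push Not at hq0
  obtain ⟨j, hj, hjmin⟩ : ∃ j, q j ≠ 0 ∧ ∀ u < j, q u = 0 :=
    ⟨Nat.find hq0, Nat.find_spec hq0, fun u hu => by
      have := Nat.find_min hq0 hu; simpa using this⟩
  replace hj : 0 < q j := lt_of_le_of_ne (hF.q_nonneg j) hj.symm
  -- Up to `j + 1`, either everyone or nobody stops.
  have hstep : ∀ i ≤ j, 0 < S (i + 1) → S (i + 1) = S i := by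
    intro i hij hSi
    by_contra hne
    have hlt : 0 < S i - S (i + 1) := by
      have := lt_of_le_of_ne (hF.S_succ_le i) hne; linarith
    have hBi : 0 < B (i + 1) := hSi.trans_le (hF.S_le_B _)
    -- The largest scale that `Feasible.scale` allows.
    set e := min ((S i - S (i + 1)) / S (i + 1)) (q j / B (i + 1)) with he
    have hepos : 0 < e := lt_min (by positivity) (by positivity)
    have hfeas := hF.scale hK0 hij hepos.le
      (by rw [← le_div_iff₀ hSi]; exact min_le_left _ _)
      (by rw [← le_div_iff₀ hBi]; exact min_le_right _ _)
    have hval := hmin _ _ _ hfeas (by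
      rw [planValue_scale hΔS hq]
      have := mul_nonneg hepos.le (htrunc i)
      linarith)
    rw [tsum_mul_scaleFromPaying hwq] at hval
    -- There is no loss before `j` and the weights decrease, so every loss after `i` has at most the
    -- weight of `j`.
    have hle : ∑' u, (if i + 1 ≤ u then (1 / 2 : ℝ) ^ u * q u else 0) ≤
        (1 / 2 : ℝ) ^ j * ∑' u, (if i + 1 ≤ u then q u else 0) := by
      rw [← tsum_mul_left]
      have hsum2 : Summable fun u => if i + 1 ≤ u then q u else 0 :=
        summable_ite_le hq _
      have hsum1 : Summable fun u => if i + 1 ≤ u then (1 / 2 : ℝ) ^ u * q u else 0 :=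
        summable_ite_le hwq _
      refine hsum1.tsum_le_tsum (fun u => ?_) (hsum2.mul_left _)
      split_ifs
      · rcases lt_or_ge u j with h | h
        · simp [hjmin u h]
        · exact mul_le_mul_of_nonneg_right
            (pow_le_pow_of_le_one (by norm_num) (by norm_num) h) (hF.q_nonneg u)
      · simp
    have hcost := hF.S_add_tsum_q_le hK (i + 1)
    have hw : (0 : ℝ) < (1 / 2 : ℝ) ^ j := by positivity
    -- Strict because `S (i + 1) > 0`: the payment also covers delay, so more weighted loss is paid
    -- at `j` than the scaling adds.
    have h5 : (1 / 2 : ℝ) ^ j * ∑' u, (if i + 1 ≤ u then q u else 0) <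
        (1 / 2 : ℝ) ^ j * B (i + 1) := by
      gcongr
      linarith
    nlinarith
  have hSj : 0 < S j := by
    by_contra h
    have : B j ≤ 0 := (hF.bound j).trans (mul_nonpos_of_nonneg_of_nonpos hK0 (not_lt.mp h))
    linarith [hF.q_le_B j]
  have hone : ∀ i ≤ j, S i = 1 := by
    intro i
    induction i with
    | zero => intro _; exact hF.start
    | succ i ih =>
      intro hi
      rw [hstep i (by omega) (hSj.trans_le (hF.S_antitone hi)), ih (by omega)]
  -- Otherwise nobody stops at `j + 1`, and postponing `q j` keeps the value but halves its weight.
  have hzero : S (j + 1) = 0 := by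
    by_contra hne
    have hpos : 0 < S (j + 1) := lt_of_le_of_ne (hF.S_nonneg _) (Ne.symm hne)
    have hfeas := hF.postpone (hstep j le_rfl hpos)
    have h1 : HasSum (fun u => if u = j + 1 then q j else 0) (q j) := hasSum_ite_eq _ _
    have h2 : HasSum (fun u => if u = j then q j else 0) (q j) := hasSum_ite_eq _ _
    have hval := hmin _ _ _ hfeas (by
      unfold planValue
      rw [((hq.hasSum.add h1).sub h2).tsum_eq]
      simp)
    have h3 : HasSum (fun u => if u = j + 1 then (1 / 2 : ℝ) ^ (j + 1) * q j else 0) _ :=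
      hasSum_ite_eq _ _
    have h4 : HasSum (fun u => if u = j then (1 / 2 : ℝ) ^ j * q j else 0) _ := hasSum_ite_eq _ _
    have h5 := (hwq.hasSum.add h3).sub h4
    have h6 : (fun u => (1 / 2 : ℝ) ^ u *
        (q u + (if u = j + 1 then q j else 0) - (if u = j then q j else 0))) = fun u =>
        (1 / 2 : ℝ) ^ u * q u + (if u = j + 1 then (1 / 2 : ℝ) ^ (j + 1) * q j else 0) -
          (if u = j then (1 / 2 : ℝ) ^ j * q j else 0) := by
      ext u
      split_ifs <;> simp_all; ring
    rw [h6, h5.tsum_eq, pow_succ] at hval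
    have : (0 : ℝ) < (1 / 2 : ℝ) ^ j * q j := by positivity
    linarith
  have hSzero : ∀ u, j + 1 ≤ u → S u = 0 := fun u hu =>
    le_antisymm (hzero ▸ hF.S_antitone hu) (hF.S_nonneg u)
  -- With no survival the bound leaves no cost, hence no loss, after `j`.
  have hBzero : B (j + 1) ≤ 0 := by
    have := hF.bound (j + 1); rwa [hzero, mul_zero] at this
  have hqzero : ∀ u, u ≠ j → q u = 0 := by
    intro u hu
    rcases lt_or_gt_of_ne hu with h | h
    · exact hjmin u h
    · exact le_antisymm ((hF.q_le_B u).trans ((hF.B_antitone h).trans hBzero)) (hF.q_nonneg u)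
  have hcost : ∀ n ≤ j, (n : ℝ) + B n ≤ K₀ := by
    intro n
    induction n with
    | zero => intro _; simpa using hF.budget
    | succ n ih =>
      intro hn
      have h1 := ih (by omega)
      have h2 := hF.cost n
      rw [hone n (by omega)] at h2
      push_cast
      linarith [hF.q_nonneg n]
  have hfin : ((j + 1 : ℕ) : ℝ) + q j ≤ K₀ := by
    have h1 := hcost j le_rfl
    have h2 := hF.cost j
    rw [hone j le_rfl] at h2
    push_cast
    linarith [hF.B_nonneg (j + 1)]
  refine ⟨j + 1, by omega, by linarith, ?_⟩
  have h1 : ∑' u, q u = q j := tsum_eq_single j hqzero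
  have h2 : ∑' u, Δ u * S u = ∑ u ∈ Finset.range (j + 1), Δ u := by
    rw [tsum_eq_sum (s := Finset.range (j + 1))]
    · refine Finset.sum_congr rfl fun u hu => ?_
      rw [hone u (by simpa [Nat.lt_succ_iff] using hu), mul_one]
    · intro u hu
      rw [hSzero u (by simpa using hu), mul_zero]
  unfold planValue
  rw [h1, h2]
  have : β * q j ≤ β * (K₀ - ((j + 1 : ℕ) : ℝ)) := by
    gcongr; linarith
  linarith

end Exchange

/-! ### Optimal plans when the value may be infinite -/

/-- The designer's value of a plan, in `[0, ∞]`. -/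
noncomputable def planValueE (h : ℕ → ℝ≥0) (β : ℝ) (S q : ℕ → ℝ) : ℝ≥0∞ :=
  h 0 + ∑' u, ((h (u + 1) - h u : ℝ≥0) : ℝ≥0∞) * ENNReal.ofReal (S u) +
    ENNReal.ofReal β * ∑' u, ENNReal.ofReal (q u)

/-- This plan attains `costBound` in every period, with `B u = K * S u` from `u = 1` on. It shows
that the decay bound is sharp, so that without summability of the majorant a lossless plan already
has infinite value. -/
lemma feasible_geometric {K K₀ : ℝ} (hK₀ : 1 ≤ K₀) (hK : K₀ ≤ K) :
    Feasible K K₀ (fun u => if u = 0 then 1 else costBound K K₀ u / K) (fun _ => 0)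
      (costBound K K₀) := by
  have h1K : 1 ≤ K := hK₀.trans hK
  have hKpos : 0 < K := by linarith
  have hr0 : 0 ≤ 1 - 1 / K := by rw [sub_nonneg, div_le_one hKpos]; exact h1K
  have hr1 : 1 - 1 / K ≤ 1 := by
    have : 0 ≤ 1 / K := by positivity
    linarith
  refine ⟨by simp, fun u => ?_, fun u => ?_, fun _ => le_rfl, costBound_nonneg h1K hK₀,
    fun u => ?_, fun u => ?_, le_rfl⟩
  · have := costBound_nonneg h1K hK₀ u
    split_ifs <;> positivity
  · cases u with
    | zero =>
      simp only [costBound]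
      simp only [zero_add, one_ne_zero, if_false, pow_zero, mul_one, if_true]
      rw [div_le_one hKpos]; linarith
    | succ u =>
      simp only [costBound, Nat.add_eq_zero_iff, one_ne_zero, and_false, if_false]
      have h1 := pow_le_pow_of_le_one hr0 hr1 (Nat.le_succ u)
      have h2 := mul_le_mul_of_nonneg_left h1 (sub_nonneg.mpr hK₀)
      gcongr
  · cases u with
    | zero => simp [costBound]
    | succ u =>
      simp only [costBound, Nat.add_eq_zero_iff, one_ne_zero, and_false, if_false]
      apply le_of_eq
      rw [pow_succ]
      generalize (1 - 1 / K) ^ u = x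
      field_simp
      ring
  · cases u with
    | zero => simpa [costBound] using hK
    | succ u =>
      simp only [costBound, Nat.add_eq_zero_iff, one_ne_zero, and_false, if_false]
      apply le_of_eq
      field_simp

theorem exists_optimal_plan_form {K K₀ β : ℝ} (hK₀ : 1 ≤ K₀) (hK : K₀ ≤ K) (hβ : 0 ≤ β)
    {h : ℕ → ℝ≥0} (hh : Monotone h) :
    (∃ S B, Feasible K K₀ S (fun _ => 0) B ∧ ∀ S' q' B', Feasible K K₀ S' q' B' →
      planValueE h β S' q' ≤ planValueE h β S (fun _ => 0)) ∨
    ∃ T : ℕ, 1 ≤ T ∧ (T : ℝ) ≤ K₀ ∧ ∀ S' q' B', Feasible K K₀ S' q' B' →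
      planValueE h β S' q' ≤ h T + ENNReal.ofReal (β * (K₀ - T)) := by
  have h1K : 1 ≤ K := hK₀.trans hK
  have hKpos : 0 < K := by linarith
  set Δ : ℕ → ℝ := fun u => ((h (u + 1) - h u : ℝ≥0) : ℝ) with hΔdef
  have hΔ : ∀ u, 0 ≤ Δ u := fun u => NNReal.coe_nonneg _
  have hΔ' : ∀ u, Δ u = h (u + 1) - h u := fun u => NNReal.coe_sub (hh (Nat.le_succ u))
  have hcoe : ∀ u, ((h (u + 1) - h u : ℝ≥0) : ℝ≥0∞) = ENNReal.ofReal (Δ u) := fun u => by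
    rw [hΔdef, ENNReal.ofReal_coe_nnreal]
  by_cases hs : Summable fun u => Δ u * costBound K K₀ u
  · have hval : ∀ S q B, Feasible K K₀ S q B →
        planValueE h β S q = ENNReal.ofReal (h 0 + planValue Δ β S q) := by
      intro S q B hF
      have hΔS0 : ∀ u, 0 ≤ Δ u * S u := fun u => mul_nonneg (hΔ u) (hF.S_nonneg u)
      unfold planValueE planValue
      rw [ENNReal.ofReal_add (NNReal.coe_nonneg _)
          (add_nonneg (tsum_nonneg hΔS0) (mul_nonneg hβ (tsum_nonneg hF.q_nonneg))),
        ENNReal.ofReal_add (tsum_nonneg hΔS0) (mul_nonneg hβ (tsum_nonneg hF.q_nonneg)),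
        ENNReal.ofReal_mul hβ, ENNReal.ofReal_tsum_of_nonneg hF.q_nonneg (hF.summable_q h1K),
        ENNReal.ofReal_tsum_of_nonneg hΔS0 (hF.summable_ΔS h1K hΔ hs), ENNReal.ofReal_coe_nnreal,
        add_assoc]
      congr 3
      ext u
      rw [hcoe, ENNReal.ofReal_mul (hΔ u)]
    obtain ⟨S, q, B, hF, hopt, hmin⟩ := exists_optimal_plan (β := β) h1K hK₀ hΔ hs
    rcases optimal_plan_form h1K hβ hΔ hs hF hopt hmin with hq | ⟨T, hT1, hT2, hT3⟩
    · left
      obtain rfl : q = fun _ => 0 := funext hq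
      refine ⟨S, B, hF, fun S' q' B' hF' => ?_⟩
      rw [hval _ _ _ hF, hval _ _ _ hF']
      exact ENNReal.ofReal_le_ofReal (by linarith [hopt _ _ _ hF'])
    · right
      refine ⟨T, hT1, hT2, fun S' q' B' hF' => ?_⟩
      rw [hval _ _ _ hF', ← ENNReal.ofReal_coe_nnreal, ← ENNReal.ofReal_add (NNReal.coe_nonneg _)
        (mul_nonneg hβ (by linarith))]
      refine ENNReal.ofReal_le_ofReal ?_
      have h1 := hopt _ _ _ hF'
      have h2 : ∑ u ∈ Finset.range T, Δ u = h T - h 0 := by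
        simp only [hΔ']
        exact Finset.sum_range_sub (fun u => ((h u : ℝ≥0) : ℝ)) T
      rw [h2] at hT3
      linarith
  -- The series diverges on the majorant, hence on the geometric plan, which differs from it by the
  -- factor `K` from `u = 1` on.
  · left
    have hF := feasible_geometric hK₀ hK
    refine ⟨_, _, hF, fun S' q' B' _ => ?_⟩
    suffices htop : ∑' u, ((h (u + 1) - h u : ℝ≥0) : ℝ≥0∞) *
        ENNReal.ofReal ((fun u => if u = 0 then 1 else costBound K K₀ u / K) u) = ∞ by
      unfold planValueE
      rw [htop]
      simp
    by_contra hne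
    apply hs
    have h1 := ENNReal.summable_toReal hne
    simp only [hcoe, ENNReal.toReal_mul, ENNReal.toReal_ofReal (hΔ _)] at h1
    rw [← summable_nat_add_iff 1] at h1 ⊢
    refine (h1.mul_right K).congr fun u => ?_
    rw [ENNReal.toReal_ofReal]
    · simp only [Nat.add_eq_zero_iff, one_ne_zero, and_false, if_false]
      field_simp
    · exact hF.S_nonneg (u + 1)

/-! ### Losses relative to full information -/

/-- Expected utility of a fully informed decision maker. -/
def fullInfo (u : Fin 2 → Fin 2 → ℝ) (μ : ℝ) : ℝ := (1 - μ) * u 0 0 + μ * u 1 1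

/-- The loss from taking action `a` at belief `μ`, relative to full information. -/
def loss (u : Fin 2 → Fin 2 → ℝ) (a : Fin 2) (μ : ℝ) : ℝ :=
  if a = 1 then (u 0 0 - u 1 0) * (1 - μ) else (u 1 1 - u 0 1) * μ

/-- The value of full information at belief `μ`. -/
def minLoss (u : Fin 2 → Fin 2 → ℝ) (μ : ℝ) : ℝ :=
  min ((u 1 1 - u 0 1) * μ) ((u 0 0 - u 1 0) * (1 - μ))

/-- The belief at which both actions are optimal. -/
noncomputable def kink (u : Fin 2 → Fin 2 → ℝ) : ℝ :=
  (u 0 0 - u 1 0) / ((u 0 0 - u 1 0) + (u 1 1 - u 0 1))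

/-- The optimal action at belief `μ`, in favour of action `1`. -/
noncomputable def greedy (u : Fin 2 → Fin 2 → ℝ) (μ : ℝ) : Fin 2 :=
  if expUtility u 0 μ ≤ expUtility u 1 μ then 1 else 0

section Loss

variable {u : Fin 2 → Fin 2 → ℝ} {μ : ℝ}

/-- The term `fullInfo` is affine in `μ`, so its expectation at the stopping time does not depend on
the strategy. -/
lemma expUtility_eq (a : Fin 2) (μ : ℝ) : expUtility u a μ = fullInfo u μ - loss u a μ := by
  fin_cases a <;> simp [expUtility, fullInfo, loss] <;> ring

lemma expUtility_le_iff : expUtility u 0 μ ≤ expUtility u 1 μ ↔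
    (u 0 0 - u 1 0) * (1 - μ) ≤ (u 1 1 - u 0 1) * μ := by
  rw [expUtility_eq, expUtility_eq, sub_le_sub_iff_left]
  simp [loss]

lemma loss_greedy (μ : ℝ) : loss u (greedy u μ) μ = minLoss u μ := by
  unfold greedy minLoss
  split_ifs with h
  · rw [expUtility_le_iff] at h
    simp [loss, h]
  · rw [expUtility_le_iff] at h
    simp [loss, (not_le.mp h).le]

lemma minLoss_le_loss (a : Fin 2) (μ : ℝ) : minLoss u μ ≤ loss u a μ := by
  unfold minLoss loss
  split_ifs <;> simp

lemma continuous_minLoss : Continuous (minLoss u) := by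
  unfold minLoss; fun_prop

lemma minLoss_nonneg (hu0 : u 1 0 < u 0 0) (hu1 : u 0 1 < u 1 1)
    (h0 : 0 ≤ μ) (h1 : μ ≤ 1) : 0 ≤ minLoss u μ :=
  le_min (mul_nonneg (by linarith) h0) (mul_nonneg (by linarith) (by linarith))

lemma kink_pos (hu0 : u 1 0 < u 0 0) (hu1 : u 0 1 < u 1 1) :
    0 < kink u := div_pos (by linarith) (by linarith)

lemma kink_lt_one (hu0 : u 1 0 < u 0 0) (hu1 : u 0 1 < u 1 1) :
    kink u < 1 := by
  unfold kink; rw [div_lt_one (by linarith)]; linarith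

lemma kink_eq (hu0 : u 1 0 < u 0 0) (hu1 : u 0 1 < u 1 1) :
    (u 1 1 - u 0 1) * kink u = (u 0 0 - u 1 0) * (1 - kink u) := by
  have : (u 0 0 - u 1 0) + (u 1 1 - u 0 1) ≠ 0 := by linarith
  unfold kink
  field_simp
  ring

lemma minLoss_kink (hu0 : u 1 0 < u 0 0) (hu1 : u 0 1 < u 1 1) :
    minLoss u (kink u) = (u 1 1 - u 0 1) * kink u := by
  unfold minLoss; rw [← kink_eq hu0 hu1, min_self]

lemma expUtility_le_iff_kink (hu0 : u 1 0 < u 0 0) (hu1 : u 0 1 < u 1 1) :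
    expUtility u 0 μ ≤ expUtility u 1 μ ↔ kink u ≤ μ := by
  rw [expUtility_le_iff]
  unfold kink
  rw [div_le_iff₀ (by linarith)]
  constructor <;> intro h <;> linarith

lemma minLoss_le_kink (hu0 : u 1 0 < u 0 0) (hu1 : u 0 1 < u 1 1)
    (μ : ℝ) : minLoss u μ ≤ minLoss u (kink u) := by
  rcases le_total μ (kink u) with h | h
  · rw [minLoss_kink hu0 hu1]
    exact (min_le_left _ _).trans (mul_le_mul_of_nonneg_left h (by linarith))
  · rw [minLoss_kink hu0 hu1, kink_eq hu0 hu1]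
    exact (min_le_right _ _).trans (mul_le_mul_of_nonneg_left (by linarith) (by linarith))

lemma minLoss_kink_pos (hu0 : u 1 0 < u 0 0) (hu1 : u 0 1 < u 1 1) :
    0 < minLoss u (kink u) := by
  rw [minLoss_kink hu0 hu1]
  exact mul_pos (by linarith) (kink_pos hu0 hu1)

end Loss

/-! ### Histories -/

/-- Membership in an event known at `t` depends on the path up to `t` only. -/
lemma mem_iff_of_history {t : ℕ} {A : Set Path} (hA : MeasurableSet[history t] A) {ω ω' : Path}
    (h : ∀ s ≤ t, ω s = ω' s) : ω ∈ A ↔ ω' ∈ A := by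
  obtain ⟨A', -, rfl⟩ := hA
  have : Preorder.restrictLe t ω = Preorder.restrictLe (π := fun _ => unitInterval × ℝ) t ω' := by
    ext1 ⟨s, hs⟩
    exact h s hs
  simp only [Set.mem_preimage]
  rw [this]

lemma measurable_eval_history (t : ℕ) : Measurable[history t] fun ω : Path => ω t := by
  have h1 : Measurable[history t] (Preorder.restrictLe (π := fun _ => unitInterval × ℝ) t) :=
    comap_measurable _
  exact (measurable_pi_apply (⟨t, Set.mem_Iic.mpr le_rfl⟩ : Set.Iic t)).comp h1

lemma measurable_belief_history (t : ℕ) : Measurable[history t] (belief t) :=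
  measurable_subtype_coe.comp (measurable_fst.comp (measurable_eval_history t))

lemma measurable_belief (t : ℕ) : Measurable (belief t) :=
  (measurable_belief_history t).mono (history.le t) le_rfl

lemma belief_nonneg (t : ℕ) (ω : Path) : 0 ≤ belief t ω := (ω t).1.2.1

lemma belief_le_one (t : ℕ) (ω : Path) : belief t ω ≤ 1 := (ω t).1.2.2

lemma measurable_greedy (u : Fin 2 → Fin 2 → ℝ) : Measurable (greedy u) := by
  refine Measurable.ite ?_ measurable_const measurable_const
  refine measurableSet_le ?_ ?_ <;> unfold expUtility <;> fun_prop

instance {prior : unitInterval} (S : InfoStructure prior) : IsProbabilityMeasure S.law := S.isProb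

/-- The belief process evaluated at a random time. -/
lemma measurable_belief_comp {τ : Path → ℕ} (hτ : Measurable τ) :
    Measurable fun ω => belief (τ ω) ω := by
  have h : Measurable fun x : ℕ × Path => belief x.1 x.2 :=
    measurable_from_prod_countable_right fun n => measurable_belief n
  exact h.comp (hτ.prodMk measurable_id)

lemma untopD_natCast (n : ℕ) : ((n : WithTop ℕ)).untopD 0 = n := rfl

lemma untopD_min_natCast (n m : ℕ) : (min (n : WithTop ℕ) (m : WithTop ℕ)).untopD 0 = min n m := by
  rcases le_total n m with h | h
  · rw [min_eq_left h, min_eq_left (by exact_mod_cast h), untopD_natCast]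
  · rw [min_eq_right h, min_eq_right (by exact_mod_cast h), untopD_natCast]

/-! ### Optional stopping, costs and obedience -/

namespace Strategy

variable {prior : unitInterval} {S : InfoStructure prior}

lemma measurable_time (s : Strategy S) : Measurable s.time :=
  (measurable_of_countable fun n : WithTop ℕ => n.untopD 0).comp s.isStoppingTime.measurable'

lemma tau_eq_time (s : Strategy S) : ∀ᵐ ω ∂S.law, s.tau ω = (s.time ω : WithTop ℕ) := by
  filter_upwards [s.finite] with ω hω
  unfold time
  cases h : s.tau ω with
  | top => exact absurd h hω
  | coe n => rfl

lemma measurable_action (s : Strategy S) : Measurable s.action := by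
  have h : Measurable fun x : ℕ × Path => s.act x.1 x.2 :=
    measurable_from_prod_countable_right fun n => (s.adapted n).mono (history.le n) le_rfl
  exact h.comp (s.measurable_time.prodMk measurable_id)

lemma measurable_stopBelief (s : Strategy S) : Measurable s.stopBelief :=
  measurable_belief_comp s.measurable_time

lemma integrable_belief_comp {τ : Path → ℕ} (hτ : Measurable τ) :
    Integrable (fun ω => belief (τ ω) ω) S.law := by
  refine Integrable.of_bound (measurable_belief_comp hτ).aestronglyMeasurable 1 ?_
  refine Filter.Eventually.of_forall fun ω => ?_
  rw [Real.norm_of_nonneg (belief_nonneg _ _)]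
  exact belief_le_one _ _

lemma integrable_time (s : Strategy S) : Integrable (fun ω => (s.time ω : ℝ)) S.law := s.integrable

/-- The increment from `N` to `N + 1` counts only on `N < τ`, an event of the history at `N`, where
the martingale property makes its mean vanish. -/
lemma integral_belief_min (s : Strategy S) (N : ℕ) :
    ∫ ω, belief (min (s.time ω) N) ω ∂S.law = prior := by
  induction N with
  | zero =>
    have : (fun ω => belief (min (s.time ω) 0) ω) =ᵐ[S.law] fun _ => (prior : ℝ) := by
      filter_upwards [S.initial] with ω hω
      simp [belief, hω]
    rw [integral_congr_ae this]
    simp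
  | succ N ih =>
    have hmeas : MeasurableSet[history N] {ω | (N : WithTop ℕ) < s.tau ω} :=
      s.isStoppingTime.measurableSet_gt N
    have hmeas' := history.le N _ hmeas
    have hint : ∀ t, Integrable (belief t) S.law := fun t => S.martingale.integrable t
    have h1 : (fun ω => belief (min (s.time ω) (N + 1)) ω) =ᵐ[S.law] fun ω =>
        belief (min (s.time ω) N) ω + {ω | (N : WithTop ℕ) < s.tau ω}.indicator
          (fun ω => belief (N + 1) ω - belief N ω) ω := by
      filter_upwards [s.tau_eq_time] with ω hω
      by_cases hN : N < s.time ω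
      · rw [Set.indicator_of_mem (by change _ < s.tau ω; rw [hω]; exact_mod_cast hN),
          min_eq_right (by omega), min_eq_right hN.le]
        ring
      · rw [Set.indicator_of_notMem (by change ¬ _ < s.tau ω; rw [hω]; exact_mod_cast hN),
          min_eq_left (by omega), min_eq_left (by omega), add_zero]
    have hsub : Integrable (fun ω => belief (N + 1) ω - belief N ω) S.law := (hint _).sub (hint _)
    rw [integral_congr_ae h1, integral_add
      (integrable_belief_comp (s.measurable_time.min measurable_const))
      (hsub.indicator hmeas'), ih, integral_indicator hmeas',
      integral_sub (hint _).integrableOn (hint _).integrableOn,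
      S.martingale.setIntegral_eq (Nat.le_succ N) hmeas]
    simp

/-- Optional stopping. -/
lemma integral_stopBelief (s : Strategy S) : ∫ ω, s.stopBelief ω ∂S.law = prior := by
  have h := tendsto_integral_of_dominated_convergence (μ := S.law)
    (F := fun N ω => belief (min (s.time ω) N) ω) (f := s.stopBelief) (fun _ => 1)
    (fun N => (measurable_belief_comp
      (s.measurable_time.min measurable_const)).aestronglyMeasurable)
    (integrable_const _)
    (fun N => Filter.Eventually.of_forall fun _ => by
      rw [Real.norm_of_nonneg (belief_nonneg _ _)]; exact belief_le_one _ _)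
    (Filter.Eventually.of_forall fun ω => by
      refine tendsto_const_nhds.congr' ?_
      filter_upwards [Filter.eventually_ge_atTop (s.time ω)] with N hN
      rw [min_eq_left hN]; rfl)
  simp only [s.integral_belief_min] at h
  exact tendsto_nhds_unique h tendsto_const_nhds |>.symm ▸ rfl

lemma measurable_loss (u : Fin 2 → Fin 2 → ℝ) (s : Strategy S) :
    Measurable fun ω => loss u (s.action ω) (s.stopBelief ω) := by
  have h1 := s.measurable_stopBelief
  refine Measurable.ite (s.measurable_action (measurableSet_singleton 1)) ?_ ?_ <;> fun_prop

lemma abs_loss_le (u : Fin 2 → Fin 2 → ℝ) (a : Fin 2) {μ : ℝ} (h0 : 0 ≤ μ) (h1 : μ ≤ 1) :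
    |loss u a μ| ≤ |u 0 0 - u 1 0| + |u 1 1 - u 0 1| := by
  have hA := abs_nonneg (u 0 0 - u 1 0)
  have hB := abs_nonneg (u 1 1 - u 0 1)
  unfold loss
  split_ifs
  · rw [abs_mul, abs_of_nonneg (sub_nonneg.mpr h1)]
    nlinarith
  · rw [abs_mul, abs_of_nonneg h0]
    nlinarith

lemma integrable_loss (u : Fin 2 → Fin 2 → ℝ) (s : Strategy S) :
    Integrable (fun ω => loss u (s.action ω) (s.stopBelief ω)) S.law :=
  Integrable.of_bound (s.measurable_loss u).aestronglyMeasurable _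
    (Filter.Eventually.of_forall fun _ =>
      abs_loss_le u _ (belief_nonneg _ _) (belief_le_one _ _))

lemma integrable_minLoss_comp (u : Fin 2 → Fin 2 → ℝ) {τ : Path → ℕ} (hτ : Measurable τ) :
    Integrable (fun ω => minLoss u (belief (τ ω) ω)) S.law := by
  refine Integrable.of_bound
    (continuous_minLoss.measurable.comp (measurable_belief_comp hτ)).aestronglyMeasurable
    (|u 0 0 - u 1 0| + |u 1 1 - u 0 1|) (Filter.Eventually.of_forall fun ω => ?_)
  rw [Real.norm_eq_abs, ← loss_greedy]
  exact abs_loss_le u _ (belief_nonneg _ _) (belief_le_one _ _)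

/-- Expected loss and delay cost of a strategy. -/
noncomputable def cost (u : Fin 2 → Fin 2 → ℝ) (c : ℝ) (s : Strategy S) : ℝ :=
  ∫ ω, (loss u (s.action ω) (s.stopBelief ω) + c * (s.time ω : ℝ)) ∂S.law

lemma dmPayoff_eq (u : Fin 2 → Fin 2 → ℝ) (c : ℝ) (s : Strategy S) :
    s.dmPayoff u c = fullInfo u prior - s.cost u c := by
  have h1 : ∫ ω, fullInfo u (s.stopBelief ω) ∂S.law = fullInfo u prior := by
    have hb : Integrable s.stopBelief S.law := integrable_belief_comp s.measurable_time
    have hb' : Integrable (fun ω => 1 - s.stopBelief ω) S.law := (integrable_const _).sub hb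
    unfold fullInfo
    rw [integral_add (hb'.mul_const _) (hb.mul_const _),
      integral_mul_const, integral_mul_const, integral_sub (integrable_const _) hb,
      s.integral_stopBelief]
    simp
  have hi : Integrable (fun ω => fullInfo u (s.stopBelief ω)) S.law := by
    have hb : Integrable s.stopBelief S.law := integrable_belief_comp s.measurable_time
    exact (((integrable_const _).sub hb).mul_const _).add (hb.mul_const _)
  have hc : Integrable (fun ω => loss u (s.action ω) (s.stopBelief ω) + c * (s.time ω : ℝ)) S.law :=
    (s.integrable_loss u).add (s.integrable_time.const_mul c)
  unfold dmPayoff cost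
  rw [← h1, ← integral_sub hi hc]
  congr 1
  ext ω
  rw [expUtility_eq]
  ring

lemma isDMOptimal_iff (u : Fin 2 → Fin 2 → ℝ) (c : ℝ) (s : Strategy S) :
    s.IsDMOptimal u c ↔ ∀ s' : Strategy S, s.cost u c ≤ s'.cost u c := by
  unfold IsDMOptimal
  simp only [dmPayoff_eq]
  exact forall_congr' fun s' => by constructor <;> intro h <;> linarith

/-- Follow `s` until time `N` at most, and take the optimal action upon stopping. -/
noncomputable def truncate (u : Fin 2 → Fin 2 → ℝ) (s : Strategy S) (N : WithTop ℕ) :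
    Strategy S where
  tau ω := min (s.tau ω) N
  isStoppingTime := by
    cases N with
    | top => simpa using s.isStoppingTime
    | coe N => exact s.isStoppingTime.min (isStoppingTime_const _ N)
  finite := by
    filter_upwards [s.finite] with ω hω h
    rw [min_eq_top] at h
    exact hω h.1
  integrable := by
    have hae : (fun ω => (((min (s.tau ω) N).untopD 0 : ℕ) : ℝ)) =ᵐ[S.law]
        fun ω => (((min (s.time ω : WithTop ℕ) N).untopD 0 : ℕ) : ℝ) := by
      filter_upwards [s.tau_eq_time] with ω hω
      rw [hω]
    refine Integrable.congr ?_ hae.symm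
    refine s.integrable_time.mono' ?_ (Filter.Eventually.of_forall fun ω => ?_)
    · have : Measurable fun n : ℕ => (((min (n : WithTop ℕ) N).untopD 0 : ℕ) : ℝ) :=
        measurable_of_countable _
      exact (this.comp s.measurable_time).aestronglyMeasurable
    · rw [Real.norm_of_nonneg (Nat.cast_nonneg _)]
      cases N with
      | top => rw [min_top_right, untopD_natCast]
      | coe N =>
        refine Nat.cast_le.mpr ((le_of_eq (untopD_min_natCast (s.time ω) N)).trans ?_)
        exact min_le_left _ _
  act t ω := greedy u (belief t ω)
  adapted t := (measurable_greedy u).comp (measurable_belief_history t)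

lemma cost_truncate_coe (u : Fin 2 → Fin 2 → ℝ) (c : ℝ) (s : Strategy S) (N : ℕ) :
    (s.truncate u N).cost u c = ∫ ω, (minLoss u (belief (min (s.time ω) N) ω) +
      c * ((min (s.time ω) N : ℕ) : ℝ)) ∂S.law := by
  refine integral_congr_ae ?_
  filter_upwards [s.tau_eq_time] with ω hω
  have ht : (s.truncate u N).time ω = min (s.time ω) N := by
    change (min (s.tau ω) N).untopD 0 = _
    rw [hω, untopD_min_natCast]
  have h1 : (s.truncate u N).action ω = greedy u ((s.truncate u N).stopBelief ω) := rfl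
  have h2 : (s.truncate u N).stopBelief ω = belief (min (s.time ω) N) ω := by
    rw [← ht]; rfl
  rw [h1, loss_greedy, h2, ht]

lemma cost_truncate_top (u : Fin 2 → Fin 2 → ℝ) (c : ℝ) (s : Strategy S) :
    (s.truncate u ⊤).cost u c = ∫ ω, (minLoss u (s.stopBelief ω) + c * (s.time ω : ℝ)) ∂S.law := by
  unfold cost
  congr 1
  ext ω
  have ht : (s.truncate u ⊤).time ω = s.time ω := by
    change (min (s.tau ω) ⊤).untopD 0 = _
    rw [min_top_right]; rfl
  have h1 : (s.truncate u ⊤).action ω = greedy u ((s.truncate u ⊤).stopBelief ω) := rfl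
  have h2 : (s.truncate u ⊤).stopBelief ω = s.stopBelief ω := by
    unfold stopBelief; rw [ht]
  rw [h1, loss_greedy, h2, ht]

/-- An optimal strategy takes an optimal action. -/
lemma IsDMOptimal.loss_eq {u : Fin 2 → Fin 2 → ℝ} {c : ℝ} {s : Strategy S}
    (hs : s.IsDMOptimal u c) :
    ∀ᵐ ω ∂S.law, loss u (s.action ω) (s.stopBelief ω) = minLoss u (s.stopBelief ω) := by
  -- Truncation at `⊤` keeps the stopping time and only replaces the action by the greedy one.
  have h1 := (isDMOptimal_iff u c s).mp hs (s.truncate u ⊤)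
  have hm : Integrable (fun ω => minLoss u (s.stopBelief ω)) S.law :=
    integrable_minLoss_comp u s.measurable_time
  have hl := s.integrable_loss u
  have ht := s.integrable_time.const_mul c
  rw [cost_truncate_top, cost, integral_add hl ht, integral_add hm ht] at h1
  have h2 : ∫ ω, (loss u (s.action ω) (s.stopBelief ω) - minLoss u (s.stopBelief ω)) ∂S.law =
      0 := by
    apply le_antisymm
    · rw [integral_sub hl hm]; linarith
    · exact integral_nonneg fun ω => sub_nonneg.mpr (minLoss_le_loss _ _)
  rw [integral_eq_zero_iff_of_nonneg (fun ω => sub_nonneg.mpr (minLoss_le_loss _ _))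
    (hl.sub hm)] at h2
  filter_upwards [h2] with ω hω
  exact sub_eq_zero.mp hω

/-- Obedience: an optimal strategy is no more costly than stopping at `N` at the latest. -/
lemma IsDMOptimal.obedience {u : Fin 2 → Fin 2 → ℝ} {c : ℝ} {s : Strategy S}
    (hs : s.IsDMOptimal u c) (N : ℕ) :
    ∫ ω, (minLoss u (s.stopBelief ω) + c * (s.time ω : ℝ)) ∂S.law ≤
      ∫ ω, (minLoss u (belief (min (s.time ω) N) ω) + c * ((min (s.time ω) N : ℕ) : ℝ)) ∂S.law := by
  have h1 := (isDMOptimal_iff u c s).mp hs (s.truncate u N)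
  rw [cost_truncate_coe] at h1
  refine le_trans (le_of_eq ?_) h1
  refine integral_congr_ae ?_
  filter_upwards [hs.loss_eq] with ω hω
  rw [hω]

/-- The decision whether to stop immediately is deterministic. -/
lemma time_zero_or_pos (s : Strategy S) :
    (∀ᵐ ω ∂S.law, s.time ω = 0) ∨ ∀ᵐ ω ∂S.law, 0 < s.time ω := by
  have hA : MeasurableSet[history 0] {ω | s.tau ω ≤ (0 : ℕ)} := s.isStoppingTime 0
  -- The initial entry is almost surely `(prior, 0)`, so an event of the history at `0` can be
  -- tested on one path.
  have hiff : ∀ᵐ ω ∂S.law, s.tau ω ≤ (0 : ℕ) ↔ s.tau (fun _ => (prior, 0)) ≤ (0 : ℕ) := by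
    filter_upwards [S.initial] with ω hω
    exact mem_iff_of_history hA (fun t ht => by rw [Nat.le_zero.mp ht, hω])
  by_cases h0 : s.tau (fun _ => (prior, 0)) ≤ (0 : ℕ)
  · left
    filter_upwards [hiff, s.tau_eq_time] with ω h1 h2
    have := h1.mpr h0
    rw [h2] at this
    exact Nat.le_zero.mp (by exact_mod_cast this)
  · right
    filter_upwards [hiff, s.tau_eq_time] with ω h1 h2
    have := fun h => h0 (h1.mp h)
    rw [h2] at this
    by_contra h3
    exact this (by exact_mod_cast not_lt.mp h3)

end Strategy

/-! ### From strategies to plans -/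

/-- Layer-cake formula for a monotone function of an integer-valued random variable. -/
lemma lintegral_monotone_comp {Ω : Type*} [MeasurableSpace Ω] (P : Measure Ω)
    [IsProbabilityMeasure P] {τ : Ω → ℕ} (hτ : Measurable τ) {h : ℕ → ℝ≥0} (hh : Monotone h) :
    ∫⁻ ω, (h (τ ω) : ℝ≥0∞) ∂P =
      h 0 + ∑' u, ((h (u + 1) - h u : ℝ≥0) : ℝ≥0∞) * P {ω | u < τ ω} := by
  have hmeas : ∀ u, MeasurableSet {ω | u < τ ω} := fun u => measurableSet_lt measurable_const hτ
  have hpt : ∀ ω, (h (τ ω) : ℝ≥0∞) = h 0 + ∑' u, {ω | u < τ ω}.indicator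
      (fun _ => ((h (u + 1) - h u : ℝ≥0) : ℝ≥0∞)) ω := by
    intro ω
    rw [tsum_eq_sum (s := Finset.range (τ ω))]
    · have h1 : ∀ n, h n = h 0 + ∑ u ∈ Finset.range n, (h (u + 1) - h u) := by
        intro n
        rw [Finset.sum_range_tsub hh, add_tsub_cancel_of_le (hh (Nat.zero_le n))]
      conv_lhs => rw [h1 (τ ω)]
      push_cast
      congr 1
      refine Finset.sum_congr rfl fun u hu => ?_
      rw [Set.indicator_of_mem (by simpa using hu)]
    · intro u hu
      exact Set.indicator_of_notMem (by simpa using hu) _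
  simp_rw [hpt]
  rw [lintegral_add_left measurable_const, lintegral_tsum fun u =>
    (measurable_const.indicator (hmeas u)).aemeasurable]
  simp only [lintegral_const, measure_univ, mul_one]
  congr 2
  ext u
  rw [lintegral_indicator_const (hmeas u)]

namespace Strategy

variable {prior : unitInterval} {S : InfoStructure prior} {u : Fin 2 → Fin 2 → ℝ} {c : ℝ}

/-- The probability of stopping after `t`. -/
noncomputable def survival (s : Strategy S) (t : ℕ) : ℝ := S.law.real {ω | t < s.time ω}

/-- The normalized loss upon stopping at `t + 1`. -/
noncomputable def stopLoss (u : Fin 2 → Fin 2 → ℝ) (c : ℝ) (s : Strategy S) (t : ℕ) : ℝ :=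
  ∫ ω, (if s.time ω = t + 1 then minLoss u (s.stopBelief ω) / c else 0) ∂S.law

/-- The normalized cost from continuing at `t`. -/
noncomputable def contCost (u : Fin 2 → Fin 2 → ℝ) (c : ℝ) (s : Strategy S) (t : ℕ) : ℝ :=
  ∫ ω, (if t < s.time ω then ((s.time ω : ℝ) - t) + minLoss u (s.stopBelief ω) / c else 0) ∂S.law

lemma measurableSet_lt_time (s : Strategy S) (t : ℕ) : MeasurableSet {ω | t < s.time ω} :=
  measurableSet_lt measurable_const s.measurable_time

lemma integrable_ite {f : Path → ℝ} (hf : Integrable f S.law) {p : Path → Prop} [DecidablePred p]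
    (hp : MeasurableSet {ω | p ω}) : Integrable (fun ω => if p ω then f ω else 0) S.law := by
  have : (fun ω => if p ω then f ω else 0) = {ω | p ω}.indicator f := by
    ext ω
    by_cases h : p ω
    · rw [if_pos h, Set.indicator_of_mem (show ω ∈ {ω | p ω} from h)]
    · rw [if_neg h, Set.indicator_of_notMem (show ω ∉ {ω | p ω} from h)]
  rw [this]
  exact hf.indicator hp

lemma survival_eq_integral (s : Strategy S) (t : ℕ) :
    s.survival t = ∫ ω, (if t < s.time ω then (1 : ℝ) else 0) ∂S.law := by
  have : (fun ω => if t < s.time ω then (1 : ℝ) else 0) =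
      {ω | t < s.time ω}.indicator fun _ => (1 : ℝ) := by
    ext ω
    by_cases h : t < s.time ω
    · rw [if_pos h, Set.indicator_of_mem (show ω ∈ {ω | t < s.time ω} from h)]
    · rw [if_neg h, Set.indicator_of_notMem (show ω ∉ {ω | t < s.time ω} from h)]
  rw [this, integral_indicator_const _ (s.measurableSet_lt_time t)]
  simp [survival]

lemma integrable_minLoss_div (s : Strategy S) :
    Integrable (fun ω => minLoss u (s.stopBelief ω) / c) S.law :=
  (integrable_minLoss_comp u s.measurable_time).div_const c

lemma integrable_contCost (s : Strategy S) (t : ℕ) : Integrable (fun ω =>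
    if t < s.time ω then ((s.time ω : ℝ) - t) + minLoss u (s.stopBelief ω) / c else 0) S.law :=
  integrable_ite ((s.integrable_time.sub (integrable_const _)).add s.integrable_minLoss_div)
    (s.measurableSet_lt_time t)

lemma integrable_stopLoss (s : Strategy S) (t : ℕ) : Integrable (fun ω =>
    if s.time ω = t + 1 then minLoss u (s.stopBelief ω) / c else 0) S.law :=
  integrable_ite s.integrable_minLoss_div (s.measurable_time (measurableSet_singleton (t + 1)))

/-- On `τ > t` one period elapses; then either `τ = t + 1` and the loss is incurred, or the cost at
`t + 1` remains. -/
lemma contCost_eq (s : Strategy S) (t : ℕ) :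
    s.survival t + s.stopLoss u c t + s.contCost u c (t + 1) = s.contCost u c t := by
  have h1 : Integrable (fun ω => if t < s.time ω then (1 : ℝ) else 0) S.law :=
    integrable_ite (integrable_const _) (s.measurableSet_lt_time t)
  have h12 : Integrable (fun ω => (if t < s.time ω then (1 : ℝ) else 0) +
      (if s.time ω = t + 1 then minLoss u (s.stopBelief ω) / c else 0)) S.law :=
    h1.add (s.integrable_stopLoss t)
  rw [survival_eq_integral, stopLoss, contCost, contCost,
    ← integral_add h1 (s.integrable_stopLoss t),
    ← integral_add h12 (s.integrable_contCost (t + 1))]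
  congr 1
  ext ω
  rcases lt_trichotomy (s.time ω) (t + 1) with h | h | h
  · simp [show ¬ t < s.time ω by omega, show ¬ t + 1 < s.time ω by omega, h.ne]
  · simp [h]
  · simp [show t < s.time ω by omega, h, h.ne']
    ring

/-- In `obedience` at `t`, the paths with `τ ≤ t` contribute equally to both sides and cancel. -/
lemma IsDMOptimal.mul_contCost_le (hc : 0 < c) {s : Strategy S} (hs : s.IsDMOptimal u c) (t : ℕ) :
    c * s.contCost u c t ≤ ∫ ω, (if t < s.time ω then minLoss u (belief t ω) else 0) ∂S.law := by
  have h1 := hs.obedience t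
  have hb : Integrable (fun ω => minLoss u (belief t ω)) S.law :=
    integrable_minLoss_comp u (measurable_const (a := t))
  have hi := integrable_ite hb (s.measurableSet_lt_time t)
  have hA : Integrable (fun ω => minLoss u (s.stopBelief ω) + c * (s.time ω : ℝ)) S.law :=
    (integrable_minLoss_comp u s.measurable_time).add (s.integrable_time.const_mul c)
  have hmin : Measurable fun ω => min (s.time ω) t := s.measurable_time.min measurable_const
  have hB : Integrable (fun ω => minLoss u (belief (min (s.time ω) t) ω) +
      c * ((min (s.time ω) t : ℕ) : ℝ)) S.law := by
    refine (integrable_minLoss_comp u hmin).add (Integrable.const_mul ?_ c)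
    refine s.integrable_time.mono' ?_ (Filter.Eventually.of_forall fun ω => ?_)
    · exact ((measurable_of_countable fun n : ℕ => (n : ℝ)).comp hmin).aestronglyMeasurable
    · rw [Real.norm_of_nonneg (Nat.cast_nonneg _)]
      exact Nat.cast_le.mpr (min_le_left _ _)
  rw [contCost, ← integral_const_mul]
  rw [← sub_nonpos, ← integral_sub hA hB] at h1
  rw [← sub_nonpos, ← integral_sub ((s.integrable_contCost t).const_mul c) hi]
  refine le_trans (le_of_eq ?_) h1
  congr 1
  ext ω
  by_cases h : t < s.time ω
  · simp only [h, if_true, min_eq_right h.le]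
    field_simp
    ring
  · simp only [h, if_false, min_eq_left (not_lt.mp h)]
    simp [stopBelief]

/-- An optimal strategy that does not stop immediately induces a feasible plan. -/
lemma IsDMOptimal.feasible (hu0 : u 1 0 < u 0 0) (hu1 : u 0 1 < u 1 1) (hc : 0 < c)
    {s : Strategy S} (hs : s.IsDMOptimal u c) (hpos : ∀ᵐ ω ∂S.law, 0 < s.time ω) :
    Feasible (minLoss u (kink u) / c) (minLoss u prior / c) s.survival (s.stopLoss u c)
      (s.contCost u c) := by
  have hnn : ∀ ω, 0 ≤ minLoss u (s.stopBelief ω) / c := fun ω =>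
    div_nonneg (minLoss_nonneg hu0 hu1 (belief_nonneg _ _) (belief_le_one _ _)) hc.le
  refine ⟨?_, fun t => measureReal_nonneg, fun t => ?_, fun t => ?_, fun t => ?_,
    fun t => (s.contCost_eq t).le, fun t => ?_, ?_⟩
  · have : S.law {ω | 0 < s.time ω} = 1 := prob_compl_eq_zero_iff
      (s.measurableSet_lt_time 0) |>.mp hpos
    simp [survival, measureReal_def, this]
  · exact measureReal_mono fun ω (hω : t + 1 < s.time ω) => show t < s.time ω by omega
  · refine integral_nonneg fun ω => ?_
    dsimp only
    split_ifs
    · exact hnn ω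
    · exact le_rfl
  · refine integral_nonneg fun ω => ?_
    dsimp only
    split_ifs with h
    · have : (t : ℝ) < s.time ω := by exact_mod_cast h
      have := hnn ω
      change (0 : ℝ) ≤ _
      linarith
    · exact le_rfl
  · have h1 := hs.mul_contCost_le hc t
    rw [div_mul_eq_mul_div, le_div_iff₀ hc, mul_comm]
    refine h1.trans ?_
    rw [survival_eq_integral, ← integral_const_mul]
    refine integral_mono
      (integrable_ite (integrable_minLoss_comp u (measurable_const (a := t)))
        (s.measurableSet_lt_time t))
      ((integrable_ite (integrable_const 1) (s.measurableSet_lt_time t)).const_mul _) fun ω => ?_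
    dsimp only
    split_ifs
    · rw [mul_one]; exact minLoss_le_kink hu0 hu1 _
    · simp
  · have h1 := hs.mul_contCost_le hc 0
    rw [le_div_iff₀ hc, mul_comm]
    refine h1.trans (le_of_eq ?_)
    have : (fun ω => if 0 < s.time ω then minLoss u (belief 0 ω) else 0) =ᵐ[S.law]
        fun _ => minLoss u prior := by
      filter_upwards [hpos, S.initial] with ω h2 h3
      rw [if_pos h2]
      simp [belief, h3]
    rw [integral_congr_ae this]
    simp

lemma lintegral_time_eq (s : Strategy S) {h : ℕ → ℝ≥0} (hh : Monotone h) (β : ℝ) :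
    s.designerValue (fun _ t => h t) = planValueE h β s.survival (fun _ => 0) := by
  unfold designerValue planValueE
  rw [lintegral_monotone_comp S.law s.measurable_time hh]
  simp [survival]

lemma lintegral_action_time (s : Strategy S) (h : ℕ → ℝ≥0) :
    s.designerValue (fun a t => ((a : ℕ) : ℝ≥0) + h t) =
      ∫⁻ ω, (((s.action ω : ℕ) : ℝ≥0) : ℝ≥0∞) ∂S.law + s.designerValue (fun _ t => h t) := by
  unfold designerValue
  have hm : Measurable fun a : Fin 2 => (((a : ℕ) : ℝ≥0) : ℝ≥0∞) := measurable_of_countable _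
  simp only [ENNReal.coe_add]
  exact lintegral_add_left (hm.comp s.measurable_action) _

/-- Pointwise `a ≤ μ + loss / (u 0 0 - u 1 0)`, with equality for `a = 1`, whose loss is `(u 0 0 - u
1 0) * (1 - μ)`. The stopping belief has mean `prior`. -/
lemma IsDMOptimal.lintegral_action_le (hu0 : u 1 0 < u 0 0) (hu1 : u 0 1 < u 1 1) (hc : 0 < c)
    {s : Strategy S} (hs : s.IsDMOptimal u c) (hpos : ∀ᵐ ω ∂S.law, 0 < s.time ω) :
    ∫⁻ ω, (((s.action ω : ℕ) : ℝ≥0) : ℝ≥0∞) ∂S.law ≤ ENNReal.ofReal prior +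
      ENNReal.ofReal (c / (u 0 0 - u 1 0)) * ∑' t, ENNReal.ofReal (s.stopLoss u c t) := by
  have hk : 0 < u 0 0 - u 1 0 := by linarith
  have hnn : ∀ ω, 0 ≤ minLoss u (s.stopBelief ω) / c := fun ω =>
    div_nonneg (minLoss_nonneg hu0 hu1 (belief_nonneg _ _) (belief_le_one _ _)) hc.le
  have hb : Integrable s.stopBelief S.law := integrable_belief_comp s.measurable_time
  have hbm : Measurable fun ω => ENNReal.ofReal (s.stopBelief ω) :=
    ENNReal.measurable_ofReal.comp s.measurable_stopBelief
  have h1 : ENNReal.ofReal prior = ∫⁻ ω, ENNReal.ofReal (s.stopBelief ω) ∂S.law := by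
    rw [← s.integral_stopBelief, ofReal_integral_eq_lintegral_ofReal hb
      (Filter.Eventually.of_forall fun ω => belief_nonneg _ _)]
  have h2 : ∀ t, ENNReal.ofReal (s.stopLoss u c t) = ∫⁻ ω, ENNReal.ofReal
      (if s.time ω = t + 1 then minLoss u (s.stopBelief ω) / c else 0) ∂S.law := fun t => by
    rw [stopLoss, ofReal_integral_eq_lintegral_ofReal (s.integrable_stopLoss t)]
    refine Filter.Eventually.of_forall fun ω => ?_
    change (0 : ℝ) ≤ if _ then _ else _
    split_ifs
    · exact hnn ω
    · exact le_rfl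
  have hm : ∀ t, Measurable fun ω => ENNReal.ofReal
      (if s.time ω = t + 1 then minLoss u (s.stopBelief ω) / c else 0) := fun t => by
    refine ENNReal.measurable_ofReal.comp (Measurable.ite
      (s.measurable_time (measurableSet_singleton (t + 1))) ?_ measurable_const)
    exact (continuous_minLoss.measurable.comp s.measurable_stopBelief).div_const c
  simp_rw [h2]
  rw [h1, ← lintegral_tsum fun t => (hm t).aemeasurable,
    ← lintegral_const_mul _ (Measurable.tsum hm),
    ← lintegral_add_left hbm]
  refine lintegral_mono_ae ?_
  filter_upwards [hs.loss_eq, hpos] with ω hω hω0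
  obtain ⟨t, ht⟩ : ∃ t, s.time ω = t + 1 := ⟨s.time ω - 1, by omega⟩
  -- Only the term of the actual stopping date survives; the index shift uses `τ > 0`.
  rw [tsum_eq_single t (fun t' ht' => by rw [if_neg (by omega), ENNReal.ofReal_zero]), if_pos ht,
    ← ENNReal.ofReal_mul (by positivity),
    ← ENNReal.ofReal_add (show 0 ≤ s.stopBelief ω from belief_nonneg _ _)
      (mul_nonneg (by positivity) (hnn ω))]
  by_cases ha : s.action ω = 1
  · rw [ha] at hω ⊢
    have h3 : s.stopBelief ω + c / (u 0 0 - u 1 0) * (minLoss u (s.stopBelief ω) / c) = 1 := by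
      rw [← hω]
      simp only [loss, if_true]
      field_simp
      ring
    rw [h3]
    simp
  · have : s.action ω = 0 := by
      revert ha; generalize s.action ω = a; fin_cases a <;> simp
    rw [this]
    simp

/-- The value to the designer of an optimal strategy that does not stop immediately. -/
lemma IsDMOptimal.designerValue_le (hu0 : u 1 0 < u 0 0) (hu1 : u 0 1 < u 1 1) (hc : 0 < c)
    {s : Strategy S} (hs : s.IsDMOptimal u c) (hpos : ∀ᵐ ω ∂S.law, 0 < s.time ω)
    {h : ℕ → ℝ≥0} (hh : Monotone h) :
    s.designerValue (fun a t => ((a : ℕ) : ℝ≥0) + h t) ≤ ENNReal.ofReal prior +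
      planValueE h (c / (u 0 0 - u 1 0)) s.survival (s.stopLoss u c) := by
  rw [lintegral_action_time, s.lintegral_time_eq hh (c / (u 0 0 - u 1 0))]
  refine (add_le_add_left (hs.lintegral_action_le hu0 hu1 hc hpos) _).trans (le_of_eq ?_)
  simp only [planValueE, ENNReal.ofReal_zero, tsum_zero, mul_zero, add_zero]
  ring

/-- The value to the designer of an optimal strategy that stops immediately. -/
lemma IsDMOptimal.designerValue_zero_le {s : Strategy S} (hs : s.IsDMOptimal u c)
    (hu0 : u 1 0 < u 0 0) (hu1 : u 0 1 < u 1 1) (hzero : ∀ᵐ ω ∂S.law, s.time ω = 0)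
    (h : ℕ → ℝ≥0) :
    s.designerValue (fun a t => ((a : ℕ) : ℝ≥0) + h t) ≤
      (if kink u ≤ prior then 1 else 0) + h 0 := by
  have hpt : ∀ᵐ ω ∂S.law, ((((s.action ω : ℕ) : ℝ≥0) + h (s.time ω) : ℝ≥0) : ℝ≥0∞) ≤
      (if kink u ≤ prior then 1 else 0) + h 0 := by
    filter_upwards [hs.loss_eq, hzero, S.initial] with ω h1 h2 h3
    rw [h2, ENNReal.coe_add]
    refine add_le_add_left ?_ _
    split_ifs with hk
    · generalize s.action ω = a
      fin_cases a <;> simp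
    · have hb : s.stopBelief ω = prior := by simp [stopBelief, h2, belief, h3]
      by_cases ha : s.action ω = 1
      · exfalso
        rw [← expUtility_le_iff_kink hu0 hu1, expUtility_le_iff] at hk
        rw [ha, hb] at h1
        simp only [loss, if_true, minLoss] at h1
        rw [min_eq_left (not_le.mp hk).le] at h1
        linarith
      · have : s.action ω = 0 := by
          revert ha; generalize s.action ω = a; fin_cases a <;> simp
        rw [this]
        simp
  refine (lintegral_mono_ae hpt).trans ?_
  simp

lemma designerValue_time_zero {s : Strategy S} (hzero : ∀ᵐ ω ∂S.law, s.time ω = 0)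
    (h : ℕ → ℝ≥0) : s.designerValue (fun _ t => h t) = h 0 := by
  unfold designerValue
  have : (fun ω => (h (s.time ω) : ℝ≥0∞)) =ᵐ[S.law] fun _ => (h 0 : ℝ≥0∞) := by
    filter_upwards [hzero] with ω hω
    rw [hω]
  rw [lintegral_congr_ae this]
  simp

end Strategy

/-! ### Structures that recommend when to stop -/

/-- The path with beliefs `b t` until time `x.1`, when the belief jumps to `x.2` for good. Message
`1` recommends to stop. -/
def recPath (b : ℕ → unitInterval) (x : ℕ × unitInterval) : Path :=
  fun t => if t < x.1 then (b t, 0) else (x.2, 1)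

lemma measurable_recPath (b : ℕ → unitInterval) : Measurable (recPath b) := by
  refine measurable_pi_iff.mpr fun t => ?_
  refine Measurable.ite (measurableSet_lt measurable_const measurable_fst) measurable_const ?_
  exact measurable_snd.prodMk measurable_const

lemma measurableSet_lt_fst (t : ℕ) : MeasurableSet {x : ℕ × unitInterval | t < x.1} :=
  measurableSet_lt measurable_const measurable_fst

lemma belief_recPath_of_lt {b : ℕ → unitInterval} {t : ℕ} {x : ℕ × unitInterval} (h : t < x.1) :
    belief t (recPath b x) = b t := by
  simp [belief, recPath, h]

lemma belief_recPath_of_le {b : ℕ → unitInterval} {t : ℕ} {x : ℕ × unitInterval} (h : x.1 ≤ t) :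
    belief t (recPath b x) = x.2 := by
  simp [belief, recPath, not_lt.mpr h]

/-- `ρ` is a joint law of a stopping time and a stopping belief, and `b` are the beliefs while
continuing, such that the recommendation to stop is obeyed. -/
structure IsRecommendation (u : Fin 2 → Fin 2 → ℝ) (c : ℝ) (prior : unitInterval)
    (ρ : Measure (ℕ × unitInterval)) (b : ℕ → unitInterval) : Prop where
  isProb : IsProbabilityMeasure ρ
  pos : ∀ᵐ x ∂ρ, 0 < x.1
  start : b 0 = prior
  integrable : Integrable (fun x => (x.1 : ℝ)) ρ
  mean : ∀ t : ℕ, ∫ x in {x | t < x.1}, (x.2 : ℝ) ∂ρ = b t * ρ.real {x | t < x.1}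
  obey : ∀ t : ℕ, ∫ x in {x | t < x.1}, (minLoss u x.2 + c * ((x.1 : ℝ) - t)) ∂ρ ≤
    minLoss u (b t) * ρ.real {x | t < x.1}

namespace IsRecommendation

variable {u : Fin 2 → Fin 2 → ℝ} {c : ℝ} {prior : unitInterval}
  {ρ : Measure (ℕ × unitInterval)} {b : ℕ → unitInterval}

lemma integrable_snd [IsProbabilityMeasure ρ] : Integrable (fun x => (x.2 : ℝ)) ρ := by
  refine Integrable.of_bound (measurable_subtype_coe.comp measurable_snd).aestronglyMeasurable 1 ?_
  refine Filter.Eventually.of_forall fun x => ?_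
  rw [Real.norm_of_nonneg x.2.2.1]
  exact x.2.2.2

lemma integrable_belief_recPath [IsProbabilityMeasure ρ] (t : ℕ) :
    Integrable (fun x => belief t (recPath b x)) ρ := by
  refine Integrable.of_bound
    ((measurable_belief t).comp (measurable_recPath b)).aestronglyMeasurable 1 ?_
  refine Filter.Eventually.of_forall fun x => ?_
  rw [Real.norm_of_nonneg (belief_nonneg _ _)]
  exact belief_le_one _ _

/-- By `mean`, `b t` and `b (t + 1)` are conditional means of one and the same stopping belief,
given `t < x.1` and `t + 1 < x.1`. -/
lemma setIntegral_belief_succ (hρ : IsRecommendation u c prior ρ b) (t : ℕ) :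
    ∫ x in {x | t < x.1}, (belief (t + 1) (recPath b x) - belief t (recPath b x)) ∂ρ = 0 := by
  have := hρ.isProb
  have hE := measurableSet_lt_fst t
  have hE' := measurableSet_lt_fst (t + 1)
  have hint : Integrable (fun x : ℕ × unitInterval => (b (t + 1) : ℝ) - x.2) ρ :=
    (integrable_const _).sub integrable_snd
  have h1 : ∫ x in {x | t < x.1}, (belief (t + 1) (recPath b x) - belief t (recPath b x)) ∂ρ =
      ∫ x in {x | t < x.1}, (((x.2 : ℝ) - b t) +
        {x : ℕ × unitInterval | t + 1 < x.1}.indicator (fun x => (b (t + 1) : ℝ) - x.2) x) ∂ρ := by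
    refine setIntegral_congr_fun hE fun x (hx : t < x.1) => ?_
    rw [belief_recPath_of_lt hx]
    by_cases hx' : t + 1 < x.1
    · rw [belief_recPath_of_lt hx', Set.indicator_of_mem (by exact hx')]
      ring
    · rw [belief_recPath_of_le (not_lt.mp hx'), Set.indicator_of_notMem (by exact hx')]
      ring
  have hint2 : Integrable (fun x : ℕ × unitInterval => (x.2 : ℝ) - b t) ρ :=
    integrable_snd.sub (integrable_const _)
  rw [h1, integral_add hint2.integrableOn (hint.indicator hE').integrableOn,
    setIntegral_indicator hE']
  have h2 : {x : ℕ × unitInterval | t < x.1} ∩ {x | t + 1 < x.1} = {x | t + 1 < x.1} := by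
    refine Set.inter_eq_right.mpr fun x (hx : t + 1 < x.1) => ?_
    exact (show t < x.1 by omega)
  rw [h2, integral_sub integrable_snd.integrableOn (integrable_const _).integrableOn,
    integral_sub (integrable_const _).integrableOn integrable_snd.integrableOn,
    hρ.mean, hρ.mean, setIntegral_const, setIntegral_const]
  simp only [smul_eq_mul]
  ring

/-- The information structure that recommends when to stop. -/
noncomputable def infoStructure (hρ : IsRecommendation u c prior ρ b) : InfoStructure prior where
  law := ρ.map (recPath b)
  isProb := by
    have := hρ.isProb
    exact Measure.isProbabilityMeasure_map (measurable_recPath b).aemeasurable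
  initial := by
    have heval : Measurable fun ω : Path => ω 0 := measurable_pi_apply 0
    have hset : MeasurableSet {ω : Path | ω 0 = (prior, 0)} :=
      heval (measurableSet_singleton (prior, (0 : ℝ)))
    rw [ae_map_iff (measurable_recPath b).aemeasurable hset]
    filter_upwards [hρ.pos] with x hx
    simp [recPath, hx, hρ.start]
  martingale := by
    have := hρ.isProb
    have hp := measurable_recPath b
    have : IsProbabilityMeasure (ρ.map (recPath b)) :=
      Measure.isProbabilityMeasure_map hp.aemeasurable
    refine martingale_of_setIntegral_eq_succ
      (fun t => (measurable_belief_history t).stronglyMeasurable) (fun t => ?_) fun t A hA => ?_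
    · rw [integrable_map_measure (measurable_belief t).aestronglyMeasurable hp.aemeasurable]
      exact integrable_belief_recPath t
    · have hA' := history.le t _ hA
      rw [setIntegral_map hA' (measurable_belief t).aestronglyMeasurable hp.aemeasurable,
        setIntegral_map hA' (measurable_belief (t + 1)).aestronglyMeasurable hp.aemeasurable,
        eq_comm, ← sub_eq_zero,
        ← integral_sub (integrable_belief_recPath _).integrableOn
          (integrable_belief_recPath _).integrableOn]
      -- Before the recommendation all histories agree with the path that never recommends to stop,
      -- so `A` contains all or none of them.
      have hmem : ∀ x : ℕ × unitInterval, t < x.1 →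
          (recPath b x ∈ A ↔ (fun s => (b s, (0 : ℝ))) ∈ A) := fun x hx =>
        mem_iff_of_history hA fun s hs => by simp [recPath, show s < x.1 by omega]
      have hsub : Integrable
          (fun x => belief (t + 1) (recPath b x) - belief t (recPath b x)) ρ :=
        (integrable_belief_recPath _).sub (integrable_belief_recPath _)
      rw [← integral_inter_add_sdiff (measurableSet_lt_fst t) hsub.integrableOn]
      have h0 : ∫ x in recPath b ⁻¹' A \ {x | t < x.1},
          (belief (t + 1) (recPath b x) - belief t (recPath b x)) ∂ρ = 0 := by
        refine setIntegral_eq_zero_of_forall_eq_zero fun x hx => ?_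
        have hx' : x.1 ≤ t := not_lt.mp hx.2
        rw [belief_recPath_of_le hx', belief_recPath_of_le (by omega), sub_self]
      rw [h0, add_zero]
      by_cases hnever : (fun s => (b s, (0 : ℝ))) ∈ A
      · have : recPath b ⁻¹' A ∩ {x | t < x.1} = {x | t < x.1} :=
          Set.inter_eq_right.mpr fun x hx => (hmem x hx).mpr hnever
        rw [this, hρ.setIntegral_belief_succ]
      · have : recPath b ⁻¹' A ∩ {x | t < x.1} = ∅ := by
          refine Set.eq_empty_of_forall_notMem fun x hx => ?_
          exact hnever ((hmem x hx.2).mp hx.1)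
        rw [this]
        simp

end IsRecommendation

open Classical in
/-- The first time at which stopping is recommended. -/
noncomputable def firstRec (ω : Path) : WithTop ℕ :=
  if h : ∃ t, (ω t).2 = 1 then (Nat.find h : WithTop ℕ) else ⊤

lemma firstRec_le_iff (ω : Path) (i : ℕ) : firstRec ω ≤ i ↔ ∃ t ≤ i, (ω t).2 = 1 := by
  classical
  unfold firstRec
  split_ifs with h
  · rw [Nat.cast_le, Nat.find_le_iff]
  · simp only [top_le_iff, WithTop.natCast_ne_top, false_iff, not_exists, not_and]
    exact fun t _ ht => h ⟨t, ht⟩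

lemma firstRec_recPath (b : ℕ → unitInterval) (x : ℕ × unitInterval) :
    firstRec (recPath b x) = (x.1 : WithTop ℕ) := by
  have hiff : ∀ i : ℕ, firstRec (recPath b x) ≤ i ↔ x.1 ≤ i := fun i => by
    rw [firstRec_le_iff]
    constructor
    · rintro ⟨t, ht, h⟩
      by_contra hlt
      simp [recPath, show t < x.1 by omega] at h
    · intro h
      exact ⟨x.1, h, by simp [recPath]⟩
  apply le_antisymm
  · exact (hiff x.1).mpr le_rfl
  · by_contra h
    rw [not_le] at h
    obtain ⟨n, hn⟩ := WithTop.ne_top_iff_exists.mp h.ne_top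
    rw [← hn] at h
    have h1 := (hiff n).mp hn.symm.le
    have h2 : n < x.1 := WithTop.coe_lt_coe.mp h
    omega

lemma measurableSet_rec (t : ℕ) : MeasurableSet[history t] {ω : Path | (ω t).2 = 1} :=
  (measurable_snd.comp (measurable_eval_history t)) (measurableSet_singleton (1 : ℝ))

lemma isStoppingTime_firstRec : IsStoppingTime history firstRec := by
  intro i
  change MeasurableSet[history i] {ω : Path | firstRec ω ≤ (i : ℕ)}
  have : {ω : Path | firstRec ω ≤ (i : ℕ)} = ⋃ t ∈ Set.Iic i, {ω : Path | (ω t).2 = 1} := by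
    ext ω
    simp only [Set.mem_iUnion]
    change firstRec ω ≤ i ↔ _
    rw [firstRec_le_iff]
    simp only [exists_prop, Set.mem_Iic]
    rfl
  rw [this]
  exact MeasurableSet.biUnion (Set.to_countable _) fun t ht =>
    history.mono ht _ (measurableSet_rec t)

namespace IsRecommendation

variable {u : Fin 2 → Fin 2 → ℝ} {c : ℝ} {prior : unitInterval}
  {ρ : Measure (ℕ × unitInterval)} {b : ℕ → unitInterval}

/-- Follow the recommendation. -/
noncomputable def strategy (hρ : IsRecommendation u c prior ρ b) : Strategy hρ.infoStructure where
  tau := firstRec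
  isStoppingTime := isStoppingTime_firstRec
  finite := by
    have hset : MeasurableSet {ω : Path | firstRec ω ≠ ⊤} :=
      isStoppingTime_firstRec.measurable' (measurableSet_singleton ⊤).compl
    change ∀ᵐ ω ∂(ρ.map (recPath b)), firstRec ω ≠ ⊤
    rw [ae_map_iff (measurable_recPath b).aemeasurable hset]
    exact Filter.Eventually.of_forall fun x => by
      rw [firstRec_recPath]; exact WithTop.natCast_ne_top _
  integrable := by
    have hm : Measurable fun ω : Path => (((firstRec ω).untopD 0 : ℕ) : ℝ) :=
      (measurable_of_countable fun n : WithTop ℕ => ((n.untopD 0 : ℕ) : ℝ)).comp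
        isStoppingTime_firstRec.measurable'
    change Integrable _ (ρ.map (recPath b))
    rw [integrable_map_measure hm.aestronglyMeasurable (measurable_recPath b).aemeasurable]
    refine hρ.integrable.congr (Filter.Eventually.of_forall fun x => ?_)
    simp only [Function.comp, firstRec_recPath, untopD_natCast]
  act t ω := greedy u (belief t ω)
  adapted t := (measurable_greedy u).comp (measurable_belief_history t)

lemma law_eq (hρ : IsRecommendation u c prior ρ b) : hρ.infoStructure.law = ρ.map (recPath b) := rfl

lemma tau_recPath (hρ : IsRecommendation u c prior ρ b) (x : ℕ × unitInterval) :
    hρ.strategy.tau (recPath b x) = (x.1 : WithTop ℕ) := firstRec_recPath b x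

lemma time_recPath (hρ : IsRecommendation u c prior ρ b) (x : ℕ × unitInterval) :
    hρ.strategy.time (recPath b x) = x.1 := by
  unfold Strategy.time
  rw [hρ.tau_recPath, untopD_natCast]

lemma stopBelief_recPath (hρ : IsRecommendation u c prior ρ b) (x : ℕ × unitInterval) :
    hρ.strategy.stopBelief (recPath b x) = x.2 := by
  unfold Strategy.stopBelief
  rw [hρ.time_recPath, belief_recPath_of_le le_rfl]

lemma action_recPath (hρ : IsRecommendation u c prior ρ b) (x : ℕ × unitInterval) :
    hρ.strategy.action (recPath b x) = greedy u x.2 := by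
  rw [← hρ.stopBelief_recPath x]; rfl

/-- A strategy coincides with a deterministic time as long as stopping is not recommended. -/
lemma tau_recPath_of_lt (hρ : IsRecommendation u c prior ρ b) (s : Strategy hρ.infoStructure)
    {x : ℕ × unitInterval} {n : ℕ} (hn : n < x.1) :
    s.tau (recPath b x) = n ↔ s.tau (fun t => (b t, 0)) = n :=
  mem_iff_of_history (s.isStoppingTime.measurableSet_eq n) fun t ht => by
    simp [recPath, show t < x.1 by omega]

/-- The cost of a strategy in excess of the recommended one. -/
noncomputable def excess (hρ : IsRecommendation u c prior ρ b) (s : Strategy hρ.infoStructure)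
    (x : ℕ × unitInterval) : ℝ :=
  loss u (s.action (recPath b x)) (s.stopBelief (recPath b x)) + c * (s.time (recPath b x) : ℝ) -
    (minLoss u x.2 + c * (x.1 : ℝ))

lemma integrable_minLoss_snd [IsProbabilityMeasure ρ] :
    Integrable (fun x : ℕ × unitInterval => minLoss u x.2) ρ := by
  refine Integrable.of_bound (continuous_minLoss.measurable.comp
    (measurable_subtype_coe.comp measurable_snd)).aestronglyMeasurable
    (|u 0 0 - u 1 0| + |u 1 1 - u 0 1|) (Filter.Eventually.of_forall fun x => ?_)
  rw [Real.norm_eq_abs, ← loss_greedy]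
  exact Strategy.abs_loss_le u _ x.2.2.1 x.2.2.2

lemma integrable_recommended (hρ : IsRecommendation u c prior ρ b) :
    Integrable (fun x : ℕ × unitInterval => minLoss u x.2 + c * (x.1 : ℝ)) ρ := by
  have := hρ.isProb
  exact integrable_minLoss_snd.add (hρ.integrable.const_mul c)

lemma integrable_cost (hρ : IsRecommendation u c prior ρ b) (s : Strategy hρ.infoStructure) :
    Integrable (fun x => loss u (s.action (recPath b x)) (s.stopBelief (recPath b x)) +
      c * (s.time (recPath b x) : ℝ)) ρ := by
  have h : Integrable (fun ω => loss u (s.action ω) (s.stopBelief ω) + c * (s.time ω : ℝ))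
      (ρ.map (recPath b)) := (s.integrable_loss u).add (s.integrable_time.const_mul c)
  exact h.comp_measurable (measurable_recPath b)

lemma cost_eq_integral (hρ : IsRecommendation u c prior ρ b) (s : Strategy hρ.infoStructure) :
    s.cost u c = ∫ x, (loss u (s.action (recPath b x)) (s.stopBelief (recPath b x)) +
      c * (s.time (recPath b x) : ℝ)) ∂ρ := by
  have h : Integrable (fun ω => loss u (s.action ω) (s.stopBelief ω) + c * (s.time ω : ℝ))
      (ρ.map (recPath b)) := (s.integrable_loss u).add (s.integrable_time.const_mul c)
  unfold Strategy.cost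
  rw [hρ.law_eq, integral_map (measurable_recPath b).aemeasurable h.aestronglyMeasurable]

lemma cost_sub_cost (hρ : IsRecommendation u c prior ρ b) (s : Strategy hρ.infoStructure) :
    s.cost u c - hρ.strategy.cost u c = ∫ x, hρ.excess s x ∂ρ := by
  unfold excess
  rw [integral_sub (hρ.integrable_cost s) hρ.integrable_recommended, hρ.cost_eq_integral,
    hρ.cost_eq_integral]
  congr 2
  ext x
  rw [hρ.time_recPath, hρ.stopBelief_recPath, hρ.action_recPath, loss_greedy]

lemma integrable_excess (hρ : IsRecommendation u c prior ρ b) (s : Strategy hρ.infoStructure) :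
    Integrable (hρ.excess s) ρ := (hρ.integrable_cost s).sub hρ.integrable_recommended

/-- The event that a strategy stops before this is recommended. -/
def stopsEarly (hρ : IsRecommendation u c prior ρ b) (s : Strategy hρ.infoStructure) :
    Set (ℕ × unitInterval) := {x | s.tau (fun t => (b t, 0)) < (x.1 : WithTop ℕ)}

lemma measurableSet_stopsEarly (hρ : IsRecommendation u c prior ρ b)
    (s : Strategy hρ.infoStructure) : MeasurableSet (hρ.stopsEarly s) :=
  measurable_fst (MeasurableSet.of_discrete (s := {k : ℕ |
    s.tau (fun t => (b t, 0)) < (k : WithTop ℕ)}))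

lemma time_lt_of_mem_stopsEarly (hρ : IsRecommendation u c prior ρ b)
    (s : Strategy hρ.infoStructure) {x : ℕ × unitInterval} (hx : x ∈ hρ.stopsEarly s) :
    s.time (recPath b x) < x.1 := by
  have hx' : s.tau (fun t => (b t, 0)) < (x.1 : WithTop ℕ) := hx
  obtain ⟨n, hn⟩ := WithTop.ne_top_iff_exists.mp hx'.ne_top
  have hlt : n < x.1 := by
    rw [← hn] at hx'
    exact WithTop.coe_lt_coe.mp hx'
  have h1 := (hρ.tau_recPath_of_lt s hlt).mpr hn.symm
  unfold Strategy.time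
  rw [h1, untopD_natCast]
  exact hlt

/-- A strategy that deviates by stopping early does so at a deterministic date `n`, read off the
path that never recommends to stop, and only while `n < x.1`. This is the deviation that `obey n`
rules out. -/
lemma setIntegral_excess_nonneg (hρ : IsRecommendation u c prior ρ b)
    (s : Strategy hρ.infoStructure) : 0 ≤ ∫ x in hρ.stopsEarly s, hρ.excess s x ∂ρ := by
  have := hρ.isProb
  cases hn : s.tau (fun t => (b t, 0)) with
  | top =>
    have : hρ.stopsEarly s = ∅ := by
      refine Set.eq_empty_of_forall_notMem fun x hx => ?_
      exact (LT.lt.ne_top hx) hn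
    rw [this]
    simp
  | coe n =>
    have hset : hρ.stopsEarly s = {x | n < x.1} := by
      ext x
      change s.tau (fun t => (b t, 0)) < (x.1 : WithTop ℕ) ↔ n < x.1
      rw [hn]
      exact WithTop.coe_lt_coe
    have hE := measurableSet_lt_fst n
    have h1 : ∫ x in {x | n < x.1}, (minLoss u (b n) -
        (minLoss u x.2 + c * ((x.1 : ℝ) - n))) ∂ρ ≤
        ∫ x in {x | n < x.1}, hρ.excess s x ∂ρ := by
      refine setIntegral_mono_on ?_ (hρ.integrable_excess s).integrableOn hE fun x hx => ?_
      · exact ((integrable_const _).sub (integrable_minLoss_snd.add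
          ((hρ.integrable.sub (integrable_const _)).const_mul c))).integrableOn
      · have hx' : n < x.1 := hx
        have ht : s.time (recPath b x) = n := by
          unfold Strategy.time
          rw [(hρ.tau_recPath_of_lt s hx').mpr hn, untopD_natCast]
        have hb : s.stopBelief (recPath b x) = b n := by
          unfold Strategy.stopBelief
          rw [ht, belief_recPath_of_lt hx']
        unfold excess
        rw [ht, hb]
        have := minLoss_le_loss (u := u) (s.action (recPath b x)) (b n)
        linarith
    rw [hset]
    refine le_trans ?_ h1
    have h2 : Integrable (fun x : ℕ × unitInterval => minLoss u x.2 + c * ((x.1 : ℝ) - n)) ρ :=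
      integrable_minLoss_snd.add ((hρ.integrable.sub (integrable_const _)).const_mul c)
    rw [integral_sub (integrable_const _).integrableOn h2.integrableOn, setIntegral_const,
      smul_eq_mul]
    linarith [hρ.obey n]

/-- After the recommendation the belief is frozen at `x.2`, so waiting adds only delay. -/
lemma le_excess (hρ : IsRecommendation u c prior ρ b) (s : Strategy hρ.infoStructure) :
    ∀ᵐ x ∂ρ, x ∉ hρ.stopsEarly s → x.1 ≤ s.time (recPath b x) ∧
      c * ((s.time (recPath b x) : ℝ) - x.1) ≤ hρ.excess s x := by
  have hfin : ∀ᵐ x ∂ρ, s.tau (recPath b x) = (s.time (recPath b x) : WithTop ℕ) :=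
    ae_of_ae_map (measurable_recPath b).aemeasurable s.tau_eq_time
  filter_upwards [hfin] with x hx hnot
  have hle : x.1 ≤ s.time (recPath b x) := by
    by_contra hlt
    rw [not_le] at hlt
    have h1 := (hρ.tau_recPath_of_lt s hlt).mp hx
    apply hnot
    change s.tau (fun t => (b t, 0)) < (x.1 : WithTop ℕ)
    rw [h1]
    exact_mod_cast hlt
  refine ⟨hle, ?_⟩
  have hb : s.stopBelief (recPath b x) = x.2 := belief_recPath_of_le hle
  unfold excess
  rw [hb]
  have := minLoss_le_loss (u := u) (s.action (recPath b x)) x.2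
  linarith

/-- Following the recommendation is the decision maker's response. -/
theorem isResponse (hc : 0 < c) (hρ : IsRecommendation u c prior ρ b) :
    hρ.strategy.IsResponse u c := by
  have hcompl : ∀ s : Strategy hρ.infoStructure, ∀ᵐ x ∂ρ.restrict (hρ.stopsEarly s)ᶜ,
      0 ≤ hρ.excess s x := by
    intro s
    rw [ae_restrict_iff' (hρ.measurableSet_stopsEarly s).compl]
    filter_upwards [hρ.le_excess s] with x hx hmem
    obtain ⟨h1, h2⟩ := hx hmem
    have : (x.1 : ℝ) ≤ s.time (recPath b x) := by exact_mod_cast h1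
    exact le_trans (mul_nonneg hc.le (by linarith)) h2
  have hsplit : ∀ s : Strategy hρ.infoStructure, s.cost u c - hρ.strategy.cost u c =
      ∫ x in hρ.stopsEarly s, hρ.excess s x ∂ρ + ∫ x in (hρ.stopsEarly s)ᶜ, hρ.excess s x ∂ρ := by
    intro s
    rw [hρ.cost_sub_cost, integral_add_compl (hρ.measurableSet_stopsEarly s)
      (hρ.integrable_excess s)]
  refine ⟨?_, fun s hs => ?_, ?_⟩
  · rw [Strategy.isDMOptimal_iff]
    intro s
    have h1 := hsplit s
    have h2 := hρ.setIntegral_excess_nonneg s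
    have h3 := integral_nonneg_of_ae (hcompl s)
    linarith
  · have h1 := hsplit s
    have h2 := hρ.setIntegral_excess_nonneg s
    have h3 := integral_nonneg_of_ae (hcompl s)
    have h4 := (Strategy.isDMOptimal_iff u c s).mp hs hρ.strategy
    -- Both parts of the excess are nonnegative and their sum is not positive. So an optimal
    -- strategy never outlasts the recommendation, and the tie-breaking towards continuing selects
    -- the recommended time.
    have h5 : ∫ x in (hρ.stopsEarly s)ᶜ, hρ.excess s x ∂ρ = 0 := by linarith
    rw [integral_eq_zero_iff_of_nonneg_ae (hcompl s) (hρ.integrable_excess s).integrableOn,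
      Filter.EventuallyEq, ae_restrict_iff' (hρ.measurableSet_stopsEarly s).compl] at h5
    have h6 : ∀ᵐ x ∂ρ, s.time (recPath b x) ≤ x.1 := by
      filter_upwards [h5, hρ.le_excess s] with x h7 h8
      by_cases hx : x ∈ hρ.stopsEarly s
      · exact (hρ.time_lt_of_mem_stopsEarly s hx).le
      · have h9 := (h8 hx).2
        rw [h7 hx] at h9
        have h10 : (s.time (recPath b x) : ℝ) - x.1 ≤ 0 := by
          by_contra hpos
          have := mul_pos hc (not_le.mp hpos)
          simp only [Pi.zero_apply] at h9
          linarith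
        have : (s.time (recPath b x) : ℝ) ≤ x.1 := by linarith
        exact_mod_cast this
    have h7 : ∀ᵐ ω ∂hρ.infoStructure.law, s.time ω ≤ hρ.strategy.time ω := by
      rw [hρ.law_eq, ae_map_iff (measurable_recPath b).aemeasurable
        (measurableSet_le s.measurable_time hρ.strategy.measurable_time)]
      filter_upwards [h6] with x hx
      rw [hρ.time_recPath]
      exact hx
    filter_upwards [h7, s.tau_eq_time, hρ.strategy.tau_eq_time] with ω h8 h9 h10
    rw [h9, h10]
    exact_mod_cast h8
  · refine Filter.Eventually.of_forall fun ω hω => ?_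
    change greedy u (hρ.strategy.stopBelief ω) = 1
    rw [greedy, if_pos hω]

lemma designerValue_eq (hρ : IsRecommendation u c prior ρ b) (f : Fin 2 → ℕ → ℝ≥0) :
    hρ.strategy.designerValue f = ∫⁻ x, (f (greedy u x.2) x.1 : ℝ≥0∞) ∂ρ := by
  have hm : Measurable fun y : Fin 2 × ℕ => (f y.1 y.2 : ℝ≥0∞) := measurable_of_countable _
  have hm' : Measurable fun ω => (f (hρ.strategy.action ω) (hρ.strategy.time ω) : ℝ≥0∞) :=
    hm.comp (hρ.strategy.measurable_action.prodMk hρ.strategy.measurable_time)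
  unfold Strategy.designerValue
  rw [hρ.law_eq, lintegral_map hm' (measurable_recPath b)]
  simp only [hρ.time_recPath, hρ.action_recPath]

lemma survival_eq (hρ : IsRecommendation u c prior ρ b) (t : ℕ) :
    hρ.strategy.survival t = ρ.real {x | t < x.1} := by
  unfold Strategy.survival
  rw [hρ.law_eq, map_measureReal_apply (measurable_recPath b)
    (hρ.strategy.measurableSet_lt_time t)]
  congr 1
  ext x
  change t < hρ.strategy.time (recPath b x) ↔ t < x.1
  rw [hρ.time_recPath]

end IsRecommendation

/-! ### Pure attention capture -/

/-- A measure on the positive integers with prescribed tails. -/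
lemma exists_measure_tail {D : ℕ → ℝ} (hD : Antitone D)
    (hlim : Filter.Tendsto D Filter.atTop (nhds 0)) :
    ∃ ν : Measure ℕ, ν {0} = 0 ∧ ∀ t : ℕ, ν {k | t < k} = ENNReal.ofReal (D t) := by
  set w : ℕ → ℝ≥0∞ := fun k => ENNReal.ofReal (D k - D (k + 1)) with hw
  have hnn : ∀ k, 0 ≤ D k - D (k + 1) := fun k => sub_nonneg.mpr (hD (Nat.le_succ k))
  have hD0 : ∀ k, 0 ≤ D k := fun k => hD.le_of_tendsto hlim k
  -- The drop from `D k` to `D (k + 1)` is the mass of `k + 1`.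
  set ν : Measure ℕ := Measure.sum fun k => w k • Measure.dirac (k + 1) with hν
  have happ : ∀ A : Set ℕ, ν A = ∑' k, w k * A.indicator 1 (k + 1) := fun A => by
    rw [hν, Measure.sum_apply _ (MeasurableSet.of_discrete)]
    simp
  have hatom0 : ν {0} = 0 := by
    rw [happ]; simp
  have hatom : ∀ t, ν {t + 1} = w t := fun t => by
    rw [happ, tsum_eq_single t (fun k hk => by simp [hk])]
    simp
  have htot : ν Set.univ = ENNReal.ofReal (D 0) := by
    rw [happ]
    have h1 : HasSum (fun k => D k - D (k + 1)) (D 0) := by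
      rw [hasSum_iff_tendsto_nat_of_nonneg hnn]
      simp only [Finset.sum_range_sub']
      simpa using tendsto_const_nhds.sub hlim
    rw [← h1.tsum_eq, ENNReal.ofReal_tsum_of_nonneg hnn h1.summable]
    simp [hw]
  refine ⟨ν, hatom0, fun t => ?_⟩
  induction t with
  | zero =>
    have h1 : (Set.univ : Set ℕ) = {0} ∪ {k | 0 < k} := by
      ext k
      simp only [Set.mem_univ, true_iff, Set.mem_union, Set.mem_singleton_iff]
      exact Nat.eq_zero_or_pos k
    have h2 : Disjoint ({0} : Set ℕ) {k | 0 < k} :=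
      Set.disjoint_singleton_left.mpr (lt_irrefl 0)
    rw [← htot, h1, measure_union h2 MeasurableSet.of_discrete, hatom0, zero_add]
  | succ t ih =>
    have h1 : {k : ℕ | t < k} = {t + 1} ∪ {k | t + 1 < k} := by
      ext k
      simp only [Set.mem_union, Set.mem_singleton_iff]
      change t < k ↔ k = t + 1 ∨ t + 1 < k
      omega
    have h2 : Disjoint ({t + 1} : Set ℕ) {k | t + 1 < k} :=
      Set.disjoint_singleton_left.mpr (lt_irrefl (t + 1))
    rw [h1, measure_union h2 MeasurableSet.of_discrete, hatom] at ih
    have h3 : ENNReal.ofReal (D t) = w t + ENNReal.ofReal (D (t + 1)) := by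
      rw [hw, ← ENNReal.ofReal_add (hnn t) (hD0 _)]
      congr 1
      ring
    rw [h3] at ih
    exact (ENNReal.add_right_inj ENNReal.ofReal_ne_top).mp ih

lemma Feasible.sum_S_le {K K₀ : ℝ} {S q B : ℕ → ℝ} (hF : Feasible K K₀ S q B) (t N : ℕ) :
    ∑ i ∈ Finset.range N, (if t ≤ i then S i else 0) ≤ B t := by
  -- The claim is strengthened by the cost still remaining at `N`, so that the cost constraints
  -- telescope.
  have h : ∑ i ∈ Finset.range N, (if t ≤ i then S i else 0) + (if t ≤ N then B N else B t) ≤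
      B t := by
    induction N with
    | zero =>
      rcases Nat.eq_zero_or_pos t with h | h
      · simp [h]
      · simp [show ¬ t ≤ 0 by omega]
    | succ N ih =>
      rw [Finset.sum_range_succ]
      have hc := hF.cost N
      have hq := hF.q_nonneg N
      rcases lt_trichotomy t (N + 1) with h | h | h
      · rw [if_pos (by omega)] at ih
        rw [if_pos (by omega), if_pos (by omega)]
        linarith
      · rw [if_neg (by omega)] at ih
        rw [if_neg (by omega), if_pos h.le, ← h]
        linarith
      · rw [if_neg (by omega)] at ih
        rw [if_neg (by omega), if_neg (by omega)]
        linarith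
  refine le_trans ?_ h
  have : 0 ≤ if t ≤ N then B N else B t := by split_ifs <;> exact hF.B_nonneg _
  linarith

/-- The expected remaining time is at most the cost of continuing. -/
lemma Feasible.lintegral_sub_le {K K₀ : ℝ} {S q B : ℕ → ℝ} (hF : Feasible K K₀ S q B)
    {Ω : Type*} [MeasurableSpace Ω] {P : Measure Ω} [IsProbabilityMeasure P] {τ : Ω → ℕ}
    (hτ : Measurable τ) (hS : ∀ t, P {ω | t < τ ω} = ENNReal.ofReal (S t)) (t : ℕ) :
    ∫⁻ ω, (((τ ω - t : ℕ) : ℝ≥0) : ℝ≥0∞) ∂P ≤ ENNReal.ofReal (B t) := by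
  have hmono : Monotone fun n : ℕ => (((n - t : ℕ)) : ℝ≥0) := fun a b hab => by
    have : a - t ≤ b - t := by omega
    exact Nat.cast_le.mpr this
  rw [lintegral_monotone_comp P hτ hmono]
  have h1 : ∀ v : ℕ, (((((v + 1 - t : ℕ)) : ℝ≥0) - ((v - t : ℕ) : ℝ≥0) : ℝ≥0) : ℝ≥0∞) *
      P {ω | v < τ ω} = ENNReal.ofReal (if t ≤ v then S v else 0) := by
    intro v
    rw [hS]
    split_ifs with h
    · rw [show v + 1 - t = (v - t) + 1 by omega]
      simp
    · rw [show v + 1 - t = 0 by omega]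
      simp
  simp only [h1]
  simp only [zero_tsub, Nat.cast_zero, ENNReal.coe_zero, zero_add]
  refine ENNReal.tsum_le_of_sum_range_le fun N => ?_
  rw [← ENNReal.ofReal_sum_of_nonneg fun i _ => by split_ifs <;> simp [hF.S_nonneg]]
  exact ENNReal.ofReal_le_ofReal (hF.sum_S_le t N)

lemma Feasible.integrable_time {K K₀ : ℝ} {S q B : ℕ → ℝ} (hF : Feasible K K₀ S q B)
    {Ω : Type*} [MeasurableSpace Ω] {P : Measure Ω} [IsProbabilityMeasure P] {τ : Ω → ℕ}
    (hτ : Measurable τ) (hS : ∀ t, P {ω | t < τ ω} = ENNReal.ofReal (S t)) (t : ℕ) :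
    Integrable (fun ω => ((τ ω - t : ℕ) : ℝ)) P ∧ ∫ ω, ((τ ω - t : ℕ) : ℝ) ∂P ≤ B t := by
  have hm : Measurable fun ω => ((τ ω - t : ℕ) : ℝ) :=
    (measurable_of_countable fun n : ℕ => ((n - t : ℕ) : ℝ)).comp hτ
  have h1 := hF.lintegral_sub_le hτ hS t
  have h2 : ∀ ω, ENNReal.ofReal ((τ ω - t : ℕ) : ℝ) = (((τ ω - t : ℕ) : ℝ≥0) : ℝ≥0∞) := fun ω => by
    simp
  have h3 : Integrable (fun ω => ((τ ω - t : ℕ) : ℝ)) P := by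
    refine ⟨hm.aestronglyMeasurable, ?_⟩
    rw [hasFiniteIntegral_iff_ofReal (Filter.Eventually.of_forall fun ω => Nat.cast_nonneg _)]
    simp only [h2]
    exact h1.trans_lt ENNReal.ofReal_lt_top
  refine ⟨h3, ?_⟩
  rw [integral_eq_lintegral_of_nonneg_ae (Filter.Eventually.of_forall fun ω => Nat.cast_nonneg _)
    hm.aestronglyMeasurable]
  simp only [h2]
  exact ENNReal.toReal_le_of_le_ofReal (hF.B_nonneg t) h1

/-- The probability of continuing at `t` in state `1`, when states are revealed so as to move the
belief towards the kink. -/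
noncomputable def contOne (m k : ℝ) (S : ℕ → ℝ) (t : ℕ) : ℝ :=
  max (min m (k * S t)) (S t - 1 + m)

section Pure

variable {u : Fin 2 → Fin 2 → ℝ} {c : ℝ} {prior : unitInterval} {S B : ℕ → ℝ}

/-- `D t` and `S t - D t` are the probabilities of continuing in states `1` and `0`. Both must
decrease, and both must be large enough that stopping at `t` costs at least `c * B t`. Clamping `k *
S t` between `S t - (1 - m)` and `m` does this: only one state is revealed until the belief reaches
the kink, where it then stays. -/
theorem exists_pure (hu0 : u 1 0 < u 0 0) (hu1 : u 0 1 < u 1 1) (hc : 0 < c)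
    (hK : 1 ≤ minLoss u (kink u) / c)
    (hF : Feasible (minLoss u (kink u) / c) (minLoss u prior / c) S (fun _ => 0) B) :
    ∃ ρ b, IsRecommendation u c prior ρ b ∧ (∀ t : ℕ, ρ {x | t < x.1} = ENNReal.ofReal (S t)) ∧
      (∀ᵐ x ∂ρ, x.2 = 0 ∨ x.2 = 1) ∧ ρ {x | x.2 = 1} = ENNReal.ofReal prior := by
  have hp0 : (0 : ℝ) ≤ prior := prior.2.1
  have hp1 : (prior : ℝ) ≤ 1 := prior.2.2
  have hk0 := kink_pos hu0 hu1
  have hk1 := kink_lt_one hu0 hu1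
  set m : ℝ := (prior : ℝ) with hm
  set k : ℝ := kink u with hk
  set D := contOne m k S with hDdef
  have hSlim : Filter.Tendsto S Filter.atTop (nhds 0) := (hF.summable_S hK).tendsto_atTop_zero
  have hD0 : ∀ t, 0 ≤ D t := fun t =>
    le_max_of_le_left (le_min hp0 (mul_nonneg hk0.le (hF.S_nonneg t)))
  have hDS : ∀ t, D t ≤ S t := fun t => by
    refine max_le ((min_le_right _ _).trans ?_) (by linarith)
    nlinarith [hF.S_nonneg t]
  have hDanti : Antitone D := fun s t hst => by
    have := hF.S_antitone hst
    refine max_le_max (min_le_min le_rfl ?_) (by linarith)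
    exact mul_le_mul_of_nonneg_left this hk0.le
  -- The same clamp for state `0`, with `1 - k` and `1 - m` in place of `k` and `m`.
  have hNeq : ∀ t, S t - D t = min (max (S t - m) ((1 - k) * S t)) (1 - m) := fun t => by
    simp only [hDdef, contOne]
    rw [← min_sub_sub_left, ← max_sub_sub_left]
    congr 1
    · congr 1; ring
    · ring
  have hNanti : Antitone fun t => S t - D t := fun s t hst => by
    have := hF.S_antitone hst
    simp only [hNeq]
    refine min_le_min (max_le_max (by linarith) ?_) le_rfl
    exact mul_le_mul_of_nonneg_left this (by linarith)
  have hDlim : Filter.Tendsto D Filter.atTop (nhds 0) :=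
    squeeze_zero hD0 hDS hSlim
  have hNlim : Filter.Tendsto (fun t => S t - D t) Filter.atTop (nhds 0) := by
    simpa using hSlim.sub hDlim
  have hDstart : D 0 = m := by
    simp only [hDdef, contOne, hF.start]
    rw [show (1 : ℝ) - 1 + m = m by ring]
    exact max_eq_right (min_le_left _ _)
  obtain ⟨ν₁, hν₁, htail₁⟩ := exists_measure_tail hDanti hDlim
  obtain ⟨ν₀, hν₀, htail₀⟩ := exists_measure_tail hNanti hNlim
  have hm1 : Measurable fun k : ℕ => (k, (1 : unitInterval)) := measurable_of_countable _
  have hm0 : Measurable fun k : ℕ => (k, (0 : unitInterval)) := measurable_of_countable _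
  set ρ : Measure (ℕ × unitInterval) := ν₁.map (fun k => (k, 1)) + ν₀.map (fun k => (k, 0)) with hρ
  have happ : ∀ A : Set (ℕ × unitInterval), MeasurableSet A →
      ρ A = ν₁ {k | (k, 1) ∈ A} + ν₀ {k | (k, 0) ∈ A} := fun A hA => by
    rw [hρ, Measure.add_apply, Measure.map_apply hm1 hA, Measure.map_apply hm0 hA]
    rfl
  have htail : ∀ t : ℕ, ρ {x | t < x.1} = ENNReal.ofReal (S t) := fun t => by
    rw [happ _ (measurableSet_lt_fst t)]
    change ν₁ {k | t < k} + ν₀ {k | t < k} = _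
    rw [htail₁, htail₀, ← ENNReal.ofReal_add (hD0 t) (sub_nonneg.mpr (hDS t))]
    congr 1
    ring
  have hone : MeasurableSet {x : ℕ × unitInterval | x.2 = 1} :=
    measurable_snd (measurableSet_singleton 1)
  have htail1 : ∀ t : ℕ, ρ ({x | x.2 = 1} ∩ {x | t < x.1}) = ENNReal.ofReal (D t) := fun t => by
    rw [happ _ (hone.inter (measurableSet_lt_fst t))]
    have h1 : {k : ℕ | (k, (1 : unitInterval)) ∈
        {x : ℕ × unitInterval | x.2 = 1} ∩ {x | t < x.1}} = {k | t < k} := by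
      ext k; exact ⟨fun h => h.2, fun h => ⟨rfl, h⟩⟩
    have h0 : {k : ℕ | (k, (0 : unitInterval)) ∈
        {x : ℕ × unitInterval | x.2 = 1} ∩ {x | t < x.1}} = ∅ :=
      Set.eq_empty_of_forall_notMem fun k h => zero_ne_one (α := unitInterval) h.1
    rw [h1, h0, htail₁, measure_empty, add_zero]
  have hpos : ∀ᵐ x ∂ρ, 0 < x.1 := by
    have hset : MeasurableSet {x : ℕ × unitInterval | ¬ 0 < x.1} := (measurableSet_lt_fst 0).compl
    rw [ae_iff, happ _ hset]
    have h1 : {k : ℕ | ¬ 0 < k} = {0} := by ext k; simp [Set.mem_singleton_iff]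
    change ν₁ {k : ℕ | ¬ 0 < k} + ν₀ {k : ℕ | ¬ 0 < k} = 0
    rw [h1, hν₁, hν₀, add_zero]
  have hprob : IsProbabilityMeasure ρ := by
    constructor
    have h1 : ρ Set.univ = ρ {x | 0 < x.1} := by
      refine measure_congr ?_
      filter_upwards [hpos] with x hx
      exact propext ⟨fun _ => hx, fun _ => trivial⟩
    rw [h1, htail, hF.start, ENNReal.ofReal_one]
  have hdeg : ∀ᵐ x ∂ρ, x.2 = 0 ∨ x.2 = 1 := by
    have hset : MeasurableSet {x : ℕ × unitInterval | ¬ (x.2 = 0 ∨ x.2 = 1)} :=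
      ((measurable_snd (measurableSet_singleton 0)).union hone).compl
    rw [ae_iff, happ _ hset]
    simp
  have htot1 : ρ {x | x.2 = 1} = ENNReal.ofReal m := by
    rw [← hDstart, ← htail1 0]
    refine measure_congr ?_
    filter_upwards [hpos] with x hx
    exact propext ⟨fun h => ⟨h, hx⟩, fun h => h.1⟩
  have hreal : ∀ t : ℕ, ρ.real {x | t < x.1} = S t := fun t => by
    rw [measureReal_def, htail, ENNReal.toReal_ofReal (hF.S_nonneg t)]
  have hreal1 : ∀ t : ℕ, ρ.real ({x | x.2 = 1} ∩ {x | t < x.1}) = D t := fun t => by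
    rw [measureReal_def, htail1, ENNReal.toReal_ofReal (hD0 t)]
  -- Bayes' rule; if `S t = 0` the quotient is `0`, which is harmless on a null event.
  refine ⟨ρ, fun t => ⟨D t / S t, div_nonneg (hD0 t) (hF.S_nonneg t),
    div_le_one_of_le₀ (hDS t) (hF.S_nonneg t)⟩, ⟨hprob, hpos, ?_, ?_, fun t => ?_, fun t => ?_⟩,
    htail, hdeg, htot1⟩
  · apply Subtype.ext
    simp only [hDstart, hF.start, div_one]
    rfl
  · have := (hF.integrable_time measurable_fst htail 0).1
    simpa using this
  · have h1 : ∫ x in {x | t < x.1}, (x.2 : ℝ) ∂ρ =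
        ∫ x in {x | t < x.1},
          {x : ℕ × unitInterval | x.2 = 1}.indicator (fun _ => (1 : ℝ)) x ∂ρ := by
      refine integral_congr_ae (ae_restrict_of_ae ?_)
      filter_upwards [hdeg] with x hx
      rcases hx with hx | hx
      · rw [Set.indicator_of_notMem, hx]
        · rfl
        · intro h
          exact zero_ne_one (α := unitInterval) (hx.symm.trans h)
      · rw [Set.indicator_of_mem (by exact hx), hx]
        rfl
    rw [h1, integral_indicator_const _ hone, measureReal_restrict_apply hone, hreal1, hreal,
      smul_eq_mul, mul_one]
    rcases eq_or_ne (S t) 0 with h | h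
    · have : D t = 0 := le_antisymm (h ▸ hDS t) (hD0 t)
      simp [h, this]
    · simp [h]
  · obtain ⟨hint, hle⟩ := hF.integrable_time (P := ρ) measurable_fst htail t
    have h1 : ∫ x in {x | t < x.1}, (minLoss u x.2 + c * ((x.1 : ℝ) - t)) ∂ρ =
        ∫ x, c * ((x.1 - t : ℕ) : ℝ) ∂ρ := by
      rw [← integral_indicator (measurableSet_lt_fst t)]
      refine integral_congr_ae ?_
      filter_upwards [hdeg] with x hx
      have hz : minLoss u x.2 = 0 := by
        rcases hx with hx | hx
        · rw [hx]
          simp [minLoss, (sub_pos.mpr hu0).le]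
        · rw [hx]
          simp [minLoss, (sub_pos.mpr hu1).le]
      by_cases hxt : t < x.1
      · rw [Set.indicator_of_mem (by exact hxt), hz, Nat.cast_sub hxt.le, zero_add]
      · rw [Set.indicator_of_notMem (by exact hxt), show x.1 - t = 0 by omega]
        simp
    rw [h1, integral_const_mul, hreal]
    refine (mul_le_mul_of_nonneg_left hle hc.le).trans ?_
    -- The kink bound handles the entries `k * S t` and `(1 - k) * S t` of the clamps, the prior
    -- bound the entries `m` and `1 - m`.
    have hB1 : c * B t ≤ minLoss u k * S t := by
      have := hF.bound t
      rw [div_mul_eq_mul_div, le_div_iff₀ hc] at this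
      linarith
    have hB2 : c * B t ≤ minLoss u m := by
      have := (hF.B_antitone (Nat.zero_le t)).trans hF.budget
      rw [le_div_iff₀ hc] at this
      linarith
    change c * B t ≤ minLoss u (D t / S t) * S t
    rcases eq_or_lt_of_le (hF.S_nonneg t) with h | h
    · rw [← h] at hB1 ⊢
      linarith
    · have h2 : minLoss u (D t / S t) * S t =
          min ((u 1 1 - u 0 1) * D t) ((u 0 0 - u 1 0) * (S t - D t)) := by
        unfold minLoss
        rw [min_mul_of_nonneg _ _ h.le]
        congr 1
        · field_simp
        · field_simp
      rw [h2]
      rw [minLoss_kink hu0 hu1] at hB1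
      have hB3 := hB1
      rw [kink_eq hu0 hu1] at hB3
      have hB4 : c * B t ≤ (u 1 1 - u 0 1) * m := hB2.trans (min_le_left _ _)
      have hB5 : c * B t ≤ (u 0 0 - u 1 0) * (1 - m) := hB2.trans (min_le_right _ _)
      apply le_min
      · have : min m (k * S t) ≤ D t := le_max_left _ _
        refine le_trans ?_ (mul_le_mul_of_nonneg_left this (by linarith))
        rw [mul_min_of_nonneg _ _ (by linarith)]
        exact le_min hB4 (by rw [← mul_assoc]; exact hB1)
      · have : min ((1 - k) * S t) (1 - m) ≤ S t - D t := by
          rw [hNeq]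
          exact min_le_min (le_max_right _ _) le_rfl
        refine le_trans ?_ (mul_le_mul_of_nonneg_left this (by linarith))
        rw [mul_min_of_nonneg _ _ (by linarith)]
        exact le_min (by rw [← mul_assoc]; exact hB3) hB5

end Pure

/-! ### One-shot persuasion -/

section OneShot

variable {u : Fin 2 → Fin 2 → ℝ} {c : ℝ} {prior : unitInterval}

/-- The measure with masses `w₁`, `w`, `w₀` at the beliefs `1`, `k`, `0` at time `T`. -/
noncomputable def threePoint (T : ℕ) (k : unitInterval) (w₁ w w₀ : ℝ) :
    Measure (ℕ × unitInterval) :=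
  ENNReal.ofReal w₁ • Measure.dirac (T, 1) + ENNReal.ofReal w • Measure.dirac (T, k) +
    ENNReal.ofReal w₀ • Measure.dirac (T, 0)

lemma lintegral_threePoint (T : ℕ) (k : unitInterval) (w₁ w w₀ : ℝ)
    (f : ℕ × unitInterval → ℝ≥0∞) :
    ∫⁻ x, f x ∂threePoint T k w₁ w w₀ = ENNReal.ofReal w₁ * f (T, 1) + ENNReal.ofReal w * f (T, k) +
      ENNReal.ofReal w₀ * f (T, 0) := by
  simp [threePoint, lintegral_add_measure, lintegral_smul_measure, lintegral_dirac]

lemma integrable_threePoint (T : ℕ) (k : unitInterval) (w₁ w w₀ : ℝ) (f : ℕ × unitInterval → ℝ) :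
    Integrable f (threePoint T k w₁ w w₀) := by
  have h : ∀ a : ℕ × unitInterval, Integrable f (Measure.dirac a) := fun a =>
    integrable_dirac (by simp)
  exact (((h _).smul_measure ENNReal.ofReal_ne_top).add_measure
    ((h _).smul_measure ENNReal.ofReal_ne_top)).add_measure
      ((h _).smul_measure ENNReal.ofReal_ne_top)

lemma integral_threePoint (T : ℕ) (k : unitInterval) {w₁ w w₀ : ℝ} (h₁ : 0 ≤ w₁) (h : 0 ≤ w)
    (h₀ : 0 ≤ w₀) (f : ℕ × unitInterval → ℝ) :
    ∫ x, f x ∂threePoint T k w₁ w w₀ = w₁ * f (T, 1) + w * f (T, k) + w₀ * f (T, 0) := by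
  have hd : ∀ a : ℕ × unitInterval, Integrable f (Measure.dirac a) := fun a =>
    integrable_dirac (by simp)
  have hs : ∀ (r : ℝ) (a : ℕ × unitInterval),
      Integrable f (ENNReal.ofReal r • Measure.dirac a) := fun r a =>
    (hd a).smul_measure ENNReal.ofReal_ne_top
  unfold threePoint
  rw [integral_add_measure ((hs _ _).add_measure (hs _ _)) (hs _ _),
    integral_add_measure (hs _ _) (hs _ _), integral_smul_measure, integral_smul_measure,
    integral_smul_measure, integral_dirac, integral_dirac, integral_dirac,
    ENNReal.toReal_ofReal h₁, ENNReal.toReal_ofReal h, ENNReal.toReal_ofReal h₀]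
  simp only [smul_eq_mul]

lemma ae_threePoint (T : ℕ) (k : unitInterval) (w₁ w w₀ : ℝ) :
    ∀ᵐ x ∂threePoint T k w₁ w w₀, x.1 = T := by
  have hset : MeasurableSet {x : ℕ × unitInterval | ¬ x.1 = T} :=
    (measurable_fst (measurableSet_singleton T)).compl
  rw [ae_iff, ← lintegral_indicator_one hset, lintegral_threePoint]
  simp

lemma greedy_one (hu1 : u 0 1 < u 1 1) : greedy u 1 = 1 := by
  unfold greedy
  rw [if_pos]
  rw [expUtility_le_iff]
  linarith

lemma greedy_zero (hu0 : u 1 0 < u 0 0) : greedy u 0 = 0 := by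
  unfold greedy
  rw [if_neg]
  rw [expUtility_le_iff]
  linarith

/-- The expected loss that the DM tolerates at `T` is `minLoss u prior - c * T`. All of it is placed
at the kink, where action `1` is still taken, and the rest of the mass on certainty. -/
theorem exists_oneShot (hu0 : u 1 0 < u 0 0) (hu1 : u 0 1 < u 1 1) (hc : 0 < c) {T : ℕ}
    (hT : 1 ≤ T) (hTK : (T : ℝ) ≤ minLoss u prior / c) :
    ∃ ρ, IsRecommendation u c prior ρ (fun _ => prior) ∧ (∀ᵐ x ∂ρ, x.1 = T) ∧
      ∀ h : ℕ → ℝ≥0, ∫⁻ x, ((((greedy u x.2 : ℕ) : ℝ≥0) + h x.1 : ℝ≥0) : ℝ≥0∞) ∂ρ =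
        ENNReal.ofReal prior +
          (h T + ENNReal.ofReal (c / (u 0 0 - u 1 0) * (minLoss u prior / c - T))) := by
  have hp0 : (0 : ℝ) ≤ prior := prior.2.1
  have hp1 : (prior : ℝ) ≤ 1 := prior.2.2
  have hk0 := kink_pos hu0 hu1
  have hk1 := kink_lt_one hu0 hu1
  have hφ := minLoss_kink hu0 hu1
  have hφpos := minLoss_kink_pos hu0 hu1
  have hkeq := kink_eq hu0 hu1
  set κ : unitInterval := ⟨kink u, hk0.le, hk1.le⟩ with hκ
  -- Chosen so that the DM is indifferent at time `0` between waiting until `T` and stopping.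
  set w : ℝ := (minLoss u prior - c * T) / minLoss u (kink u) with hw
  have hTc : c * T ≤ minLoss u prior := by
    rw [le_div_iff₀ hc] at hTK; linarith
  have hw0 : 0 ≤ w := div_nonneg (by linarith) hφpos.le
  have hcT : 0 ≤ c * T := by positivity
  have hwφ : w * minLoss u (kink u) = minLoss u prior - c * T := by
    rw [hw, div_mul_cancel₀ _ hφpos.ne']
  have hw1 : w * kink u ≤ prior := by
    have h1 : minLoss u prior ≤ (u 1 1 - u 0 1) * prior := min_le_left _ _
    rw [hφ] at hwφ
    have h2 : (u 1 1 - u 0 1) * (w * kink u) ≤ (u 1 1 - u 0 1) * prior := by linarith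
    exact le_of_mul_le_mul_left h2 (by linarith)
  have hw2 : w * (1 - kink u) ≤ 1 - prior := by
    have h1 : minLoss u prior ≤ (u 0 0 - u 1 0) * (1 - prior) := min_le_right _ _
    rw [hφ, hkeq] at hwφ
    have h2 : (u 0 0 - u 1 0) * (w * (1 - kink u)) ≤ (u 0 0 - u 1 0) * (1 - prior) := by linarith
    exact le_of_mul_le_mul_left h2 (by linarith)
  -- The remaining masses follow from total mass `1` and mean `prior`.
  set w₁ : ℝ := prior - w * kink u with hw₁
  set w₀ : ℝ := 1 - prior - w * (1 - kink u) with hw₀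
  have h₁ : 0 ≤ w₁ := by linarith
  have h₀ : 0 ≤ w₀ := by linarith
  set ρ := threePoint T κ w₁ w w₀ with hρ
  have hae : ∀ᵐ x ∂ρ, x.1 = T := ae_threePoint T κ w₁ w w₀
  have hprob : IsProbabilityMeasure ρ := by
    constructor
    have h2 : ρ Set.univ = ∫⁻ _, 1 ∂ρ := by simp
    rw [h2, hρ, lintegral_threePoint]
    simp only [mul_one]
    rw [← ENNReal.ofReal_add h₁ hw0, ← ENNReal.ofReal_add (add_nonneg h₁ hw0) h₀,
      show w₁ + w + w₀ = 1 by rw [hw₁, hw₀]; ring, ENNReal.ofReal_one]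
  have hfull : ∀ t < T, ρ.restrict {x | t < x.1} = ρ := fun t ht =>
    Measure.restrict_eq_self_of_ae_mem (by
      filter_upwards [hae] with x hx
      rw [hx]; exact ht)
  have hfull' : ∀ t < T, ρ.real {x | t < x.1} = 1 := fun t ht => by
    have h1 : ρ {x | t < x.1} = ρ Set.univ := by
      conv_rhs => rw [← hfull t ht]
      rw [Measure.restrict_apply_univ]
    rw [measureReal_def, h1, measure_univ, ENNReal.toReal_one]
  have hnull : ∀ t, T ≤ t → ρ {x | t < x.1} = 0 := fun t ht => by
    refine measure_mono_null (t := {x | ¬ x.1 = T}) (fun x hx => ?_) hae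
    have hx' : t < x.1 := hx
    change ¬ x.1 = T
    omega
  refine ⟨ρ, ⟨hprob, ?_, rfl, integrable_threePoint _ _ _ _ _ _, fun t => ?_, fun t => ?_⟩, hae,
    fun h => ?_⟩
  · filter_upwards [hae] with x hx
    omega
  · rcases lt_or_ge t T with ht | ht
    · rw [hfull t ht, hfull' t ht, hρ, integral_threePoint T κ h₁ hw0 h₀]
      simp only [hκ, Set.Icc.coe_one, Set.Icc.coe_zero]
      rw [hw₁]
      ring
    · rw [setIntegral_measure_zero _ (hnull t ht), measureReal_def, hnull t ht]
      simp
  · rcases lt_or_ge t T with ht | ht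
    · rw [hfull t ht, hfull' t ht, hρ, integral_threePoint T κ h₁ hw0 h₀]
      simp only [hκ, Set.Icc.coe_one, Set.Icc.coe_zero]
      have hm1 : minLoss u 1 = 0 := by simp [minLoss, (sub_pos.mpr hu1).le]
      have hm0 : minLoss u 0 = 0 := by simp [minLoss, (sub_pos.mpr hu0).le]
      rw [hm1, hm0]
      have hsum : w₁ + w + w₀ = 1 := by rw [hw₁, hw₀]; ring
      have h3 : 0 ≤ c * (t : ℝ) := by positivity
      have h4 : w₁ * (0 + c * ((T : ℝ) - t)) + w * (minLoss u (kink u) + c * ((T : ℝ) - t)) +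
          w₀ * (0 + c * ((T : ℝ) - t)) =
          (w₁ + w + w₀) * (c * ((T : ℝ) - t)) + w * minLoss u (kink u) := by ring
      -- The cost of waiting is `minLoss u prior - c * t`, so obedience holds with slack `c * t`.
      rw [h4, hsum, hwφ]
      linarith
    · rw [setIntegral_measure_zero _ (hnull t ht), measureReal_def, hnull t ht]
      simp
  · rw [hρ, lintegral_threePoint]
    have hgk : greedy u κ = 1 := by
      unfold greedy
      rw [if_pos ((expUtility_le_iff_kink hu0 hu1).mpr le_rfl)]
    simp only [Set.Icc.coe_one, Set.Icc.coe_zero, greedy_one hu1, greedy_zero hu0, hgk]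
    -- The gain over `prior` is the mass at the kink times the probability `1 - kink u` of state `0`
    -- there.
    have h5 : c / (u 0 0 - u 1 0) * (minLoss u prior / c - T) = w * (1 - kink u) := by
      have h6 : u 0 0 - u 1 0 ≠ 0 := by linarith
      have h7 : 1 - kink u ≠ 0 := by linarith
      rw [hw, hφ, hkeq]
      field_simp
    rw [h5]
    have h8 : ENNReal.ofReal w₁ + ENNReal.ofReal w + ENNReal.ofReal w₀ = 1 := by
      rw [← ENNReal.ofReal_add h₁ hw0, ← ENNReal.ofReal_add (add_nonneg h₁ hw0) h₀,
        show w₁ + w + w₀ = 1 by rw [hw₁, hw₀]; ring, ENNReal.ofReal_one]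
    have h9 : ENNReal.ofReal w₁ + ENNReal.ofReal w =
        ENNReal.ofReal prior + ENNReal.ofReal (w * (1 - kink u)) := by
      rw [← ENNReal.ofReal_add h₁ hw0, ← ENNReal.ofReal_add hp0 (mul_nonneg hw0 (by linarith))]
      congr 1
      rw [hw₁]
      ring
    push_cast
    simp only [Fin.val_one, Fin.val_zero, Nat.cast_one, Nat.cast_zero, zero_add]
    calc ENNReal.ofReal w₁ * (1 + (h T : ℝ≥0∞)) + ENNReal.ofReal w * (1 + h T) +
          ENNReal.ofReal w₀ * h T
        = (ENNReal.ofReal w₁ + ENNReal.ofReal w) +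
          (ENNReal.ofReal w₁ + ENNReal.ofReal w + ENNReal.ofReal w₀) * h T := by ring
      _ = _ := by rw [h8, h9]; ring

end OneShot

/-! ### No information -/

section NoInfo

variable {u : Fin 2 → Fin 2 → ℝ} {c : ℝ}

/-- The structure that never reveals anything. -/
noncomputable def noInfo (prior : unitInterval) : InfoStructure prior where
  law := Measure.dirac fun _ => (prior, 0)
  isProb := inferInstance
  initial := by
    rw [ae_dirac_eq]
    exact rfl
  martingale := by
    refine martingale_of_setIntegral_eq_succ
      (fun t => (measurable_belief_history t).stronglyMeasurable) (fun t => ?_) fun t A _ => ?_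
    · exact integrable_dirac (by simp)
    · refine integral_congr_ae (ae_restrict_of_ae ?_)
      change ∀ᵐ ω ∂Measure.dirac (fun _ => (prior, (0 : ℝ))), belief t ω = belief (t + 1) ω
      rw [ae_dirac_eq]
      exact rfl

lemma noInfo_law (prior : unitInterval) :
    (noInfo prior).law = Measure.dirac fun _ => (prior, 0) := rfl

/-- Stop immediately. -/
noncomputable def stopNow (u : Fin 2 → Fin 2 → ℝ) (prior : unitInterval) :
    Strategy (noInfo prior) where
  tau _ := ((0 : ℕ) : WithTop ℕ)
  isStoppingTime := isStoppingTime_const _ 0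
  finite := Filter.Eventually.of_forall fun _ => WithTop.natCast_ne_top 0
  integrable := by simp
  act t ω := greedy u (belief t ω)
  adapted t := (measurable_greedy u).comp (measurable_belief_history t)

lemma stopNow_isResponse (hc : 0 < c) (prior : unitInterval) :
    (stopNow u prior).IsResponse u c := by
  have hcost : ∀ s : Strategy (noInfo prior), minLoss u prior +
      c * (s.time fun _ => (prior, 0)) ≤ s.cost u c := by
    intro s
    unfold Strategy.cost
    rw [noInfo_law, integral_dirac]
    exact add_le_add (minLoss_le_loss _ _) le_rfl
  have hnow : (stopNow u prior).cost u c = minLoss u prior := by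
    unfold Strategy.cost
    rw [noInfo_law, integral_dirac]
    have ht : (stopNow u prior).time (fun _ => (prior, 0)) = 0 := rfl
    have hb : (stopNow u prior).stopBelief (fun _ => (prior, 0)) = prior := rfl
    have ha : (stopNow u prior).action (fun _ => (prior, 0)) = greedy u prior := rfl
    rw [ht, hb, ha, loss_greedy]
    simp
  refine ⟨?_, fun s hs => ?_, ?_⟩
  · rw [Strategy.isDMOptimal_iff]
    intro s
    have h1 := hcost s
    have h2 : 0 ≤ c * ((s.time fun _ => (prior, 0) : ℕ) : ℝ) := by positivity
    linarith
  · have h1 := (Strategy.isDMOptimal_iff u c s).mp hs (stopNow u prior)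
    have h2 := hcost s
    have h3 : s.time (fun _ => (prior, 0)) = 0 := by
      by_contra hne
      have : (0 : ℝ) < c * ((s.time fun _ => (prior, 0) : ℕ) : ℝ) :=
        mul_pos hc (by exact_mod_cast Nat.pos_of_ne_zero hne)
      linarith
    have h4 := s.tau_eq_time
    rw [noInfo_law, ae_dirac_eq] at h4 ⊢
    have h5 : s.tau (fun _ => (prior, 0)) = (s.time (fun _ => (prior, 0)) : WithTop ℕ) := h4
    change s.tau (fun _ => (prior, 0)) ≤ ((0 : ℕ) : WithTop ℕ)
    rw [h5, h3]
  · refine Filter.Eventually.of_forall fun ω hω => ?_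
    change greedy u ((stopNow u prior).stopBelief ω) = 1
    rw [greedy, if_pos hω]

lemma stopNow_designerValue (hu0 : u 1 0 < u 0 0) (hu1 : u 0 1 < u 1 1) (prior : unitInterval)
    (h : ℕ → ℝ≥0) : (stopNow u prior).designerValue (fun a t => ((a : ℕ) : ℝ≥0) + h t) =
      (if kink u ≤ prior then 1 else 0) + h 0 := by
  unfold Strategy.designerValue
  rw [noInfo_law, lintegral_dirac]
  have ht : (stopNow u prior).time (fun _ => (prior, 0)) = 0 := rfl
  have ha : (stopNow u prior).action (fun _ => (prior, 0)) = greedy u prior := rfl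
  rw [ht, ha, greedy]
  by_cases hk : kink u ≤ prior
  · rw [if_pos hk, if_pos ((expUtility_le_iff_kink hu0 hu1).mpr hk)]
    simp
  · rw [if_neg hk, if_neg fun h => hk ((expUtility_le_iff_kink hu0 hu1).mp h)]
    simp

lemma noInfo_revealsOnlyAt (prior : unitInterval) : (noInfo prior).RevealsOnlyAt 0 := by
  refine ⟨fun t ht => absurd ht (Nat.not_lt_zero t), fun t _ => ?_⟩
  rw [noInfo_law, ae_dirac_eq]
  exact rfl

end NoInfo

/-! ### The designer's problem -/

section Designer

variable {u : Fin 2 → Fin 2 → ℝ} {c : ℝ} {prior : unitInterval} {h : ℕ → ℝ≥0}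

/-- For the objective `h(τ)` alone the loss is worthless, so a lossless optimum also bounds this
objective. -/
lemma Feasible.drop_loss {K K₀ : ℝ} {S q B : ℕ → ℝ} (hF : Feasible K K₀ S q B) :
    Feasible K K₀ S (fun _ => 0) B :=
  ⟨hF.start, hF.S_nonneg, hF.S_succ_le, fun _ => le_rfl, hF.B_nonneg,
    fun t => by linarith [hF.cost t, hF.q_nonneg t], hF.bound, hF.budget⟩

/-- A bound on the value of plans is a bound on the value of information structures. -/
lemma designerValue_le_of_plan (hu0 : u 1 0 < u 0 0) (hu1 : u 0 1 < u 1 1) (hc : 0 < c)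
    (hh : Monotone h) {V : ℝ≥0∞}
    (hplan : ∀ S q B, Feasible (minLoss u (kink u) / c) (minLoss u prior / c) S q B →
      ENNReal.ofReal prior + planValueE h (c / (u 0 0 - u 1 0)) S q ≤ V)
    (hnow : (if kink u ≤ prior then 1 else 0) + (h 0 : ℝ≥0∞) ≤ V)
    (S : InfoStructure prior) (s : Strategy S) (hs : s.IsResponse u c) :
    s.designerValue (fun a t => ((a : ℕ) : ℝ≥0) + h t) ≤ V := by
  rcases s.time_zero_or_pos with h0 | hpos
  · exact (hs.1.designerValue_zero_le hu0 hu1 h0 h).trans hnow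
  · exact (hs.1.designerValue_le hu0 hu1 hc hpos hh).trans
      (hplan _ _ _ (hs.1.feasible hu0 hu1 hc hpos))

lemma noInfo_optimal (hu0 : u 1 0 < u 0 0) (hu1 : u 0 1 < u 1 1) (hc : 0 < c) (hh : Monotone h)
    (hplan : ∀ S q B, Feasible (minLoss u (kink u) / c) (minLoss u prior / c) S q B →
      ENNReal.ofReal prior + planValueE h (c / (u 0 0 - u 1 0)) S q ≤
        (if kink u ≤ prior then 1 else 0) + h 0) :
    IsDesignerOptimal u c (fun a t => ((a : ℕ) : ℝ≥0) + h t) (noInfo prior) (stopNow u prior) := by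
  refine ⟨stopNow_isResponse hc prior, fun S' s' hs' => ?_⟩
  rw [stopNow_designerValue hu0 hu1]
  exact designerValue_le_of_plan hu0 hu1 hc hh hplan le_rfl S' s' hs'

lemma IsRecommendation.pure_value (hu0 : u 1 0 < u 0 0) (hu1 : u 0 1 < u 1 1)
    {ρ : Measure (ℕ × unitInterval)} {b : ℕ → unitInterval} {S : ℕ → ℝ} (hh : Monotone h) (β : ℝ)
    (hρ : IsRecommendation u c prior ρ b) (hS0 : ∀ t, 0 ≤ S t)
    (htail : ∀ t : ℕ, ρ {x | t < x.1} = ENNReal.ofReal (S t))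
    (hdeg : ∀ᵐ x ∂ρ, x.2 = 0 ∨ x.2 = 1) (hone : ρ {x | x.2 = 1} = ENNReal.ofReal prior) :
    hρ.strategy.designerValue (fun _ t => h t) = planValueE h β S (fun _ => 0) ∧
    hρ.strategy.designerValue (fun a t => ((a : ℕ) : ℝ≥0) + h t) =
      ENNReal.ofReal prior + planValueE h β S (fun _ => 0) := by
  have h1 : hρ.strategy.designerValue (fun _ t => h t) = planValueE h β S (fun _ => 0) := by
    rw [hρ.strategy.lintegral_time_eq hh β]
    congr 1
    ext t
    rw [hρ.survival_eq, measureReal_def, htail, ENNReal.toReal_ofReal (hS0 t)]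
  refine ⟨h1, ?_⟩
  have hset : MeasurableSet {x : ℕ × unitInterval | x.2 = 1} :=
    measurable_snd (measurableSet_singleton 1)
  have h2 : ∫⁻ ω, (((hρ.strategy.action ω : ℕ) : ℝ≥0) : ℝ≥0∞) ∂hρ.infoStructure.law =
      ENNReal.ofReal prior := by
    refine (hρ.designerValue_eq fun a _ => ((a : ℕ) : ℝ≥0)).trans ?_
    rw [← hone, ← lintegral_indicator_one hset]
    refine lintegral_congr_ae ?_
    filter_upwards [hdeg] with x hx
    rcases hx with hx | hx
    · rw [Set.indicator_of_notMem, hx, Set.Icc.coe_zero, greedy_zero hu0]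
      · simp
      · intro h'
        exact zero_ne_one (α := unitInterval) (hx.symm.trans h')
    · rw [Set.indicator_of_mem (by exact hx), hx, Set.Icc.coe_one, greedy_one hu1]
      simp
  rw [Strategy.lintegral_action_time, h1, h2]

lemma IsRecommendation.stopsFullyInformed {ρ : Measure (ℕ × unitInterval)} {b : ℕ → unitInterval}
    (hρ : IsRecommendation u c prior ρ b) (hdeg : ∀ᵐ x ∂ρ, x.2 = 0 ∨ x.2 = 1) :
    hρ.strategy.StopsFullyInformed := by
  have hm := hρ.strategy.measurable_stopBelief
  have hset : MeasurableSet {ω | hρ.strategy.stopBelief ω = 0 ∨ hρ.strategy.stopBelief ω = 1} :=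
    (hm (measurableSet_singleton 0)).union (hm (measurableSet_singleton 1))
  unfold Strategy.StopsFullyInformed
  rw [hρ.law_eq, ae_map_iff (measurable_recPath b).aemeasurable hset]
  filter_upwards [hdeg] with x hx
  rw [hρ.stopBelief_recPath]
  rcases hx with hx | hx <;> simp [hx]

lemma IsRecommendation.revealsOnlyAt {ρ : Measure (ℕ × unitInterval)} {T : ℕ}
    (hρ : IsRecommendation u c prior ρ fun _ => prior) (hT : ∀ᵐ x ∂ρ, x.1 = T) :
    hρ.infoStructure.RevealsOnlyAt T := by
  have hp := (measurable_recPath fun _ => prior).aemeasurable (μ := ρ)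
  refine ⟨fun t ht => ?_, fun t ht => ?_⟩
  · have hset : MeasurableSet {ω : Path | belief t ω = prior} :=
      measurable_belief t (measurableSet_singleton (prior : ℝ))
    rw [hρ.law_eq, ae_map_iff hp hset]
    filter_upwards [hT] with x hx
    exact belief_recPath_of_lt (by omega)
  · have hset : MeasurableSet {ω : Path | belief t ω = belief T ω} :=
      measurableSet_eq_fun (measurable_belief t) (measurable_belief T)
    rw [hρ.law_eq, ae_map_iff hp hset]
    filter_upwards [hT] with x hx
    rw [belief_recPath_of_le (by omega), belief_recPath_of_le (by omega)]

lemma IsRecommendation.tau_eq {ρ : Measure (ℕ × unitInterval)} {b : ℕ → unitInterval} {T : ℕ}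
    (hρ : IsRecommendation u c prior ρ b) (hT : ∀ᵐ x ∂ρ, x.1 = T) :
    ∀ᵐ ω ∂hρ.infoStructure.law, hρ.strategy.tau ω = (T : WithTop ℕ) := by
  have h1 : ∀ᵐ ω ∂hρ.infoStructure.law, hρ.strategy.time ω = T := by
    have hset : MeasurableSet {ω | hρ.strategy.time ω = T} :=
      hρ.strategy.measurable_time (measurableSet_singleton T)
    rw [hρ.law_eq, ae_map_iff (measurable_recPath b).aemeasurable hset]
    filter_upwards [hT] with x hx
    rw [hρ.time_recPath, hx]
  filter_upwards [h1, hρ.strategy.tau_eq_time] with ω h2 h3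
  rw [h3, h2]

end Designer

end AttentionCapture

open AttentionCapture in
theorem proposition10 (u : Fin 2 → Fin 2 → ℝ) (hu0 : u 1 0 < u 0 0) (hu1 : u 0 1 < u 1 1)
    (c : ℝ) (hc : 0 < c) (prior : unitInterval) (hprior0 : 0 < prior) (hprior1 : prior < 1)
    (h : ℕ → ℝ≥0) (hh : Monotone h) :
    ∃ (S : AttentionCapture.InfoStructure prior) (s : AttentionCapture.Strategy S),
      AttentionCapture.IsDesignerOptimal u c (fun a t => ((a : ℕ) : ℝ≥0) + h t) S s ∧
      ((AttentionCapture.IsDesignerOptimal u c (fun _ t => h t) S s ∧ s.StopsFullyInformed) ∨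
        ∃ T : ℕ, S.RevealsOnlyAt T ∧ ∀ᵐ ω ∂S.law, s.tau ω = (T : WithTop ℕ)) := by
  have hK₀K : minLoss u prior / c ≤ minLoss u (kink u) / c := by
    gcongr
    exact minLoss_le_kink hu0 hu1 _
  have hβ : 0 ≤ c / (u 0 0 - u 1 0) := div_nonneg hc.le (by linarith)
  -- If stopping at once beats every plan, revealing nothing is optimal. Otherwise some plan is
  -- strictly better, and the optimal plan must beat stopping at once.
  by_cases hplan : ∀ S q B, Feasible (minLoss u (kink u) / c) (minLoss u prior / c) S q B →
      ENNReal.ofReal prior + planValueE h (c / (u 0 0 - u 1 0)) S q ≤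
        (if kink u ≤ prior then 1 else 0) + h 0
  · exact ⟨noInfo prior, stopNow u prior, noInfo_optimal hu0 hu1 hc hh hplan,
      Or.inr ⟨0, noInfo_revealsOnlyAt prior, Filter.Eventually.of_forall fun _ => rfl⟩⟩
  rcases lt_or_ge (minLoss u prior / c) 1 with hK₀ | hK₀
  · refine absurd (fun S q B hF => absurd (hF.S_le_B 0) ?_) hplan
    rw [hF.start]
    linarith [hF.budget]
  rcases exists_optimal_plan_form hK₀ hK₀K hβ hh with ⟨S, B, hF, hopt⟩ | ⟨T, hT1, hTK, hopt⟩
  · by_cases hnow : (if kink u ≤ prior then 1 else 0) + (h 0 : ℝ≥0∞) ≤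
        ENNReal.ofReal prior + planValueE h (c / (u 0 0 - u 1 0)) S (fun _ => 0)
    · obtain ⟨ρ, b, hρ, htail, hdeg, hone⟩ := exists_pure hu0 hu1 hc (hK₀.trans hK₀K) hF
      obtain ⟨hv, hv'⟩ := hρ.pure_value hu0 hu1 hh (c / (u 0 0 - u 1 0)) hF.S_nonneg htail hdeg hone
      refine ⟨hρ.infoStructure, hρ.strategy, ⟨hρ.isResponse hc, fun S' s' hs' => ?_⟩,
        Or.inl ⟨⟨hρ.isResponse hc, fun S' s' hs' => ?_⟩, hρ.stopsFullyInformed hdeg⟩⟩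
      · rw [hv']
        exact designerValue_le_of_plan hu0 hu1 hc hh
          (fun S q B hF' => add_le_add le_rfl (hopt S q B hF')) hnow S' s' hs'
      · rw [hv]
        rcases s'.time_zero_or_pos with h0 | hpos
        · rw [Strategy.designerValue_time_zero h0]
          -- Stopping at once yields only `h 0`, the constant term of the value of every plan.
          exact le_add_right le_self_add
        · rw [s'.lintegral_time_eq hh (c / (u 0 0 - u 1 0))]
          exact hopt _ _ _ (hs'.1.feasible hu0 hu1 hc hpos).drop_loss
    · exact absurd (fun S' q' B' hF' =>
        (add_le_add le_rfl (hopt S' q' B' hF')).trans (not_le.mp hnow).le) hplan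
  · by_cases hnow : (if kink u ≤ prior then 1 else 0) + (h 0 : ℝ≥0∞) ≤ ENNReal.ofReal prior +
        (h T + ENNReal.ofReal (c / (u 0 0 - u 1 0) * (minLoss u prior / c - T)))
    · obtain ⟨ρ, hρ, hT, hval⟩ := exists_oneShot hu0 hu1 hc hT1 hTK
      refine ⟨hρ.infoStructure, hρ.strategy, ⟨hρ.isResponse hc, fun S' s' hs' => ?_⟩,
        Or.inr ⟨T, hρ.revealsOnlyAt hT, hρ.tau_eq hT⟩⟩
      rw [hρ.designerValue_eq, hval]
      exact designerValue_le_of_plan hu0 hu1 hc hh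
        (fun S q B hF' => add_le_add le_rfl (hopt S q B hF')) hnow S' s' hs'
    · exact absurd (fun S' q' B' hF' =>
        (add_le_add le_rfl (hopt S' q' B' hF')).trans (not_le.mp hnow).le) hplan
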